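/- Let $n,m\in\mathbb N$ with $n\ge 1$, let $\alpha\in(0,1)$, and let $\Omega\subset\mathbb R^n$ be a bounded Lipschitz domain, i.e. a bounded open set whose boundary is locally the graph of a Lipschitz function with $\Omega$ locally on one side of it (connectedness is not needed). For $\phi\in C_c^\infty(\mathbb R^n;\mathbb R^{m\times n})$ with rows $\phi_1,\dots,\phi_m$ let $\operatorname{div}^\alpha\phi:\mathbb R^n\to\mathbb R^m$ be the fractional divergence with components $$(\operatorname{div}^\alpha\phi)_i(x)=\mu_{n,\alpha}\int_{\mathbb R^n}\frac{\phi_i(y)-\phi_i(x)}{|y-x|^{n+\alpha}}\cdot\frac{y-x}{|y-x|}\,dy,\qquad \mu_{n,\alpha}=2^\alpha\pi^{-n/2}\frac{\Gamma((n+\alpha+1)/2)}{\Gamma((1-\alpha)/2)}.$$ Let $BV^\alpha(\mathbb R^n;\mathbb R^m)$ be the space of all $u\in L^1(\mathbb R^n;\mathbb R^m)$ with $$\sup\Big\{\int_{\mathbb R^n}u\cdot\operatorname{div}^\alpha\phi\,dx:\ \phi\in C_c^\infty(\mathbb R^n;\mathbb R^{m\times n}),\ \|\phi\|_{L^\infty}\le1\Big\}<\infty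 .$$ For such $u$ let $D^\alpha u$ be the unique finite $\mathbb R^{m\times n}$-valued Radon measure with $\int u\cdot\operatorname{div}^\alpha\phi\,dx=-\int\phi\cdot dD^\alpha u$ for all $\phi\in C_c^\infty(\mathbb R^n;\mathbb R^{m\times n})$, and let $D^\alpha u=\nabla^\alpha u\,dx+D^\alpha_su$ be its Lebesgue decomposition into absolutely continuous and singular parts. Let $S^{\alpha,1}(\mathbb R^n;\mathbb R^m)=\{u\in BV^\alpha(\mathbb R^n;\mathbb R^m): D^\alpha_su=0\}$. For $g\in S^{\alpha,1}(\mathbb R^n;\mathbb R^m)$ let $BV^\alpha_g(\Omega;\mathbb R^m)$ be the set of all $u$ with $u-g\in BV^\alpha(\mathbb R^n;\mathbb R^m)$ and $u=g$ a.e. in $\Omega^c=\mathbb R^n\setminus\Omega$. For a finite $\mathbb R^{m\times n}$-valued Radon measure $\mu$ with singular part $\mu^s$ and a Borel set $U\subset\mathbb R^n$ put $$\langle\mu\rangle(U)=\int_U\sqrt{1+\Big|\frac{d\mu}{dx}\Big|^2}\,dx+|\mu^s|(U),$$ where $|\cdot|$ is the Frobenius norm on matrices and $|\mu^s|$ is the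 total variation measure of $\mu^s$ with respect to it. Functions in $C_c^\infty(\Omega;\mathbb R^m)$ are extended by zero to $\mathbb R^n$. **Theorem.** Let $g\in S^{\alpha,1}(\mathbb R^n;\mathbb R^m)$. For every $u\in BV^\alpha_g(\Omega;\mathbb R^m)$ there is a sequence $(u_j)_j\subset g+C_c^\infty(\Omega;\mathbb R^m)$ that converges area-strictly to $u$ in $BV^\alpha_g(\Omega;\mathbb R^m)$; that is, $u_j\in BV^\alpha_g(\Omega;\mathbb R^m)$ for all $j$ and, as $j\to\infty$, $$u_j\to u\ \text{in }L^1(\mathbb R^n;\mathbb R^m),\qquad \langle D^\alpha u_j\rangle(\overline\Omega)\to\langle D^\alpha u\rangle(\overline\Omega),\qquad \nabla^\alpha u_j\to\nabla^\alpha u\ \text{in }L^1(\Omega^c;\mathbb R^{m\times n}).$$ -/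

import Mathlib

open MeasureTheory Filter Topology
open scoped ENNReal NNReal ContDiff

namespace FractionalBV

/-- Euclidean space `ℝⁿ`. -/
abbrev Euc (n : ℕ) : Type := EuclideanSpace ℝ (Fin n)

/-- The space `ℝ^{m × n}` of matrices with the Frobenius (Euclidean) norm and inner product. -/
abbrev Mat (m n : ℕ) : Type := EuclideanSpace ℝ (Fin m × Fin n)

/-- `Ω` is a bounded open set with Lipschitz boundary: near every boundary point there is a
direction `e` such that `Ω` is the strict epigraph, in direction `e`, of a Lipschitz function `γ` of
the coordinates `y - ⟪e, y⟫ e` orthogonal to `e`. Connectedness is not required, so bounded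
Lipschitz domains in the sense of connected sets are included as a special case. -/
def IsBoundedLipschitzDomain {n : ℕ} (Ω : Set (Euc n)) : Prop :=
  IsOpen Ω ∧ Bornology.IsBounded Ω ∧
    ∀ x₀ ∈ frontier Ω, ∃ r : ℝ, 0 < r ∧ ∃ e : Euc n, ‖e‖ = 1 ∧
      ∃ (K : ℝ≥0) (γ : Euc n → ℝ), LipschitzWith K γ ∧
        ∀ y ∈ Metric.ball x₀ r, y ∈ Ω ↔ γ (y - inner ℝ e y • e) < inner ℝ e y

/-- The normalizing constant
`μ_{n,α} = 2^α π^{-n/2} Γ((n+α+1)/2) / Γ((1-α)/2)`. -/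
noncomputable def rieszConst (n : ℕ) (α : ℝ) : ℝ :=
  (2 : ℝ) ^ α * Real.pi ^ (-((n : ℝ) / 2)) *
    (Real.Gamma (((n : ℝ) + α + 1) / 2) / Real.Gamma ((1 - α) / 2))

/-- The (row-wise) fractional divergence of a matrix field `φ : ℝⁿ → ℝ^{m × n}`: its `i`-th entry
is `μ_{n,α} ∫ (φᵢ(y) - φᵢ(x)) / |y-x|^{n+α} ⬝ (y-x) / |y-x| dy`, with `φᵢ` the `i`-th row of `φ`. -/
noncomputable def fracDiv {n m : ℕ} (α : ℝ) (φ : Euc n → Mat m n) (x : Euc n) : Euc m :=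
  WithLp.toLp 2 fun i : Fin m =>
    rieszConst n α *
      ∫ y : Euc n, ∑ k : Fin n,
        (φ y (i, k) - φ x (i, k)) / ‖y - x‖ ^ ((n : ℝ) + α) * ((y k - x k) / ‖y - x‖)

/-- Membership in `C_c^∞(Ω; F)`, functions being extended by zero to `ℝⁿ`. -/
def IsTestFunction {n : ℕ} {F : Type*} [NormedAddCommGroup F] [NormedSpace ℝ F]
    (Ω : Set (Euc n)) (φ : Euc n → F) : Prop :=
  ContDiff ℝ ∞ φ ∧ HasCompactSupport φ ∧ tsupport φ ⊆ Ω

/-- `u ∈ BV^α(ℝⁿ; ℝᵐ)`: `u` is integrable and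
`sup {∫ u · div^α φ dx : φ ∈ C_c^∞(ℝⁿ; ℝ^{m × n}), ‖φ‖_∞ ≤ 1} < ∞`. -/
def MemBV {n m : ℕ} (α : ℝ) (u : Euc n → Euc m) : Prop :=
  Integrable u volume ∧
    BddAbove {t : ℝ | ∃ φ : Euc n → Mat m n, IsTestFunction Set.univ φ ∧ (∀ x, ‖φ x‖ ≤ 1) ∧
      t = ∫ x, inner ℝ (u x) (fracDiv α φ x)}

/-- The finite matrix-valued Radon measure `μ` represents the fractional variation of `u`:
`∫ u · div^α φ dx = - ∫ φ · dμ` for all `φ ∈ C_c^∞(ℝⁿ; ℝ^{m × n})`. -/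
def IsFracVariation {n m : ℕ} (α : ℝ) (u : Euc n → Euc m)
    (μ : VectorMeasure (Euc n) (Mat m n)) : Prop :=
  ∀ φ : Euc n → Mat m n, IsTestFunction Set.univ φ →
    ∫ x, inner ℝ (u x) (fracDiv α φ x) = - μ.integral φ (innerSL ℝ)

open scoped Classical in
/-- The fractional variation measure `D^α u`: the (unique) measure representing the fractional
variation of `u`, which exists for `u ∈ BV^α`. Outside `BV^α` the value `0` is a
mere convention. -/
noncomputable def fracVariation {n m : ℕ} (α : ℝ) (u : Euc n → Euc m) :
    VectorMeasure (Euc n) (Mat m n) :=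
  if h : ∃ μ, IsFracVariation α u μ then h.choose else 0

/-- The `p`-th entry of a matrix-valued measure, as a signed measure. -/
noncomputable def entry {n m : ℕ} (μ : VectorMeasure (Euc n) (Mat m n)) (p : Fin m × Fin n) :
    SignedMeasure (Euc n) :=
  μ.mapRange (EuclideanSpace.proj (𝕜 := ℝ) p : Mat m n →L[ℝ] ℝ).toAddMonoidHom
    (EuclideanSpace.proj (𝕜 := ℝ) p : Mat m n →L[ℝ] ℝ).continuous

/-- The Lebesgue density `dμ/dx` of a matrix-valued measure, taken entrywise. -/
noncomputable def acDensity {n m : ℕ} (μ : VectorMeasure (Euc n) (Mat m n)) (x : Euc n) : Mat m n :=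
  WithLp.toLp 2 fun p : Fin m × Fin n => (entry μ p).rnDeriv volume x

/-- The singular part `μ^s = μ - (dμ/dx) dx` of a matrix-valued measure with respect to
Lebesgue measure. -/
noncomputable def singPart {n m : ℕ} (μ : VectorMeasure (Euc n) (Mat m n)) :
    VectorMeasure (Euc n) (Mat m n) :=
  μ - (volume : Measure (Euc n)).withDensityᵥ (acDensity μ)

/-- The fractional gradient `∇^α u`: the density of the absolutely continuous part of `D^α u`. -/
noncomputable def fracGrad {n m : ℕ} (α : ℝ) (u : Euc n → Euc m) : Euc n → Mat m n :=
  acDensity (fracVariation α u)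

/-- `u ∈ S^{α,1}(ℝⁿ; ℝᵐ)`: `u ∈ BV^α` and the singular part of `D^α u` vanishes. -/
def MemS {n m : ℕ} (α : ℝ) (u : Euc n → Euc m) : Prop :=
  MemBV α u ∧ singPart (fracVariation α u) = 0

/-- `u ∈ BV^α_0(Ω; ℝᵐ)`: `u ∈ BV^α` and `u = 0` a.e. in the complement of `Ω`. -/
def MemBVZero {n m : ℕ} (α : ℝ) (Ω : Set (Euc n)) (u : Euc n → Euc m) : Prop :=
  MemBV α u ∧ ∀ᵐ x ∂(volume : Measure (Euc n)), x ∈ Ωᶜ → u x = 0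

/-- `u ∈ BV^α_g(Ω; ℝᵐ) = g + BV^α_0(Ω; ℝᵐ)`. -/
def MemBVg {n m : ℕ} (α : ℝ) (Ω : Set (Euc n)) (g u : Euc n → Euc m) : Prop :=
  MemBVZero α Ω (u - g)

/-- The area functional `⟨μ⟩(U) = ∫_U √(1 + |dμ/dx|²) dx + |μ^s|(U)`, where `|μ^s|` is the total
variation measure of the singular part. -/
noncomputable def areaFunctional {n m : ℕ} (μ : VectorMeasure (Euc n) (Mat m n))
    (U : Set (Euc n)) : ℝ≥0∞ :=
  (∫⁻ x in U, ENNReal.ofReal (Real.sqrt (1 + ‖acDensity μ x‖ ^ 2))) + (singPart μ).variation U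

/-- Area-strict convergence `u_j → u` in `BV^α_g(Ω; ℝᵐ)`: all functions lie in `BV^α_g(Ω; ℝᵐ)`,
`u_j → u` in `L¹(ℝⁿ)`, `⟨D^α u_j⟩(Ω̄) → ⟨D^α u⟩(Ω̄)`, and `∇^α u_j → ∇^α u` in `L¹(Ωᶜ)`. -/
def AreaStrictTendsto {n m : ℕ} (α : ℝ) (Ω : Set (Euc n)) (g : Euc n → Euc m)
    (uj : ℕ → Euc n → Euc m) (u : Euc n → Euc m) : Prop :=
  (∀ j, MemBVg α Ω g (uj j)) ∧ MemBVg α Ω g u ∧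
    Tendsto (fun j => eLpNorm (uj j - u) 1 volume) atTop (𝓝 0) ∧
    Tendsto (fun j => areaFunctional (fracVariation α (uj j)) (closure Ω)) atTop
      (𝓝 (areaFunctional (fracVariation α u) (closure Ω))) ∧
    Tendsto (fun j => eLpNorm (fracGrad α (uj j) - fracGrad α u) 1 (volume.restrict Ωᶜ)) atTop
      (𝓝 0)

end FractionalBV

/-! ### The kernel and the fractional divergence of test functions -/

namespace FractionalBV

/-! Put w = u - g, which vanishes off Ω, and write D^α w = a dx + h τ with τ singular
(`MemBV.exists_hasVariation`, from Hahn–Banach and Riesz representation). Take a partition of unity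
χ_i on the closure of Ω, fine enough that each piece can be pushed into Ω along a fixed direction.
Mollifiers η_{j,i} whose small supports are centred at such a shift then turn χ_i w into a smooth
function with compact support in Ω (`IsBoundedLipschitzDomain.exists_partition`). The approximants
are g + φ_j with φ_j = ∑_i η_{j,i} * (χ_i w).

D^α is nonlocal, but its nonlocality is harmless. By the Leibniz rule `HasVariation.smul`, cutting
off by χ multiplies D^α w by χ and adds only an L¹ function, because increments of χ against the
kernel are dominated by an integrable weight. By translation invariance D^α commutes with
convolution (`HasVariation.smear`). Hence D^α φ_j has density a + d_j + b_j, where d_j is the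
mollification error of the absolutely continuous parts and tends to 0 in L¹(ℝⁿ), while b_j = ∑_i
η_{j,i} * (χ_i h τ). The Leibniz rule also shows that the singular part is local
(`HasVariation.sing_eq_zero`), so h τ lives on the closure of Ω. Therefore b_j vanishes off Ω, which
settles the convergence on the complement; its mass is at most ∫ ‖h‖ dτ because the χ_i sum to one
on the closure; and it converges weakly to h τ.

What remains is the area (`tendsto_integral_sqrt`). The upper bound is the 1-Lipschitz property of v
↦ √(1 + ‖v‖²). For the lower bound, singularity of τ yields a continuous field ψ that almost norms h
τ and yet is small in L¹ against 1 + 2‖A‖, A being the absolutely continuous density of D^α u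
(`exists_norming_field`). Where ψ is near the unit sphere the integrand is at least about ‖b_j‖, and
elsewhere at least √(1 + ‖A‖²) - ‖b_j‖; `sqrt_one_add_add_ge` interpolates between the two, and weak
convergence tested with ψ concludes. -/

/-- The radial weight `min(‖z‖, 1) ‖z‖^{-(n+α)}`, which dominates the increments of bounded
Lipschitz functions against the kernel of the fractional divergence. -/
noncomputable def weight (n : ℕ) (α : ℝ) (z : Euc n) : ℝ :=
  min ‖z‖ 1 * (‖z‖ ^ ((n : ℝ) + α))⁻¹

/-- The kernel `μ_{n,α} ‖z‖^{-(n+α)} z / ‖z‖` of the fractional divergence. -/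
noncomputable def rieszKernel (n : ℕ) (α : ℝ) (z : Euc n) : Euc n :=
  (rieszConst n α * (‖z‖ ^ ((n : ℝ) + α))⁻¹ * ‖z‖⁻¹) • z

lemma measurable_rieszKernel (n : ℕ) (α : ℝ) : Measurable (rieszKernel n α) := by
  unfold rieszKernel; fun_prop

lemma norm_rieszKernel_le (n : ℕ) (α : ℝ) (z : Euc n) :
    min ‖z‖ 1 * ‖rieszKernel n α z‖ ≤ |rieszConst n α| * weight n α z := by
  unfold rieszKernel weight
  rcases eq_or_ne z 0 with rfl | hz
  · simp
  · have h0 : 0 < ‖z‖ := norm_pos_iff.2 hz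
    have h1 : 0 ≤ ‖z‖ ^ ((n : ℝ) + α) := by positivity
    rw [norm_smul, norm_mul, norm_mul, norm_inv, norm_inv, norm_norm, Real.norm_eq_abs,
      Real.norm_of_nonneg h1]
    apply le_of_eq
    field_simp

/-- In polar coordinates the radial integrand is t^(-α) on (0, 1], integrable because α < 1, and
t^(-1-α) beyond 1, integrable because α > 0. -/
lemma integrable_weight {n : ℕ} (hn : 1 ≤ n) {α : ℝ} (hα₀ : 0 < α) (hα₁ : α < 1) :
    Integrable (weight n α) := by
  have : Nontrivial (Euc n) := by
    have : Nonempty (Fin n) := ⟨⟨0, hn⟩⟩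
    infer_instance
  have key := integrable_fun_norm_addHaar (volume : Measure (Euc n))
    (f := fun t : ℝ => min t 1 * (t ^ ((n : ℝ) + α))⁻¹)
  refine key.2 ?_
  rw [finrank_euclideanSpace, Fintype.card_fin, ← Set.Ioc_union_Ioi_eq_Ioi zero_le_one]
  have hpow : ∀ t : ℝ, 0 < t → t ^ (n - 1) * (t ^ ((n : ℝ) + α))⁻¹ = t ^ (-1 - α) := by
    intro t ht
    rw [← Real.rpow_natCast, ← Real.rpow_neg ht.le, ← Real.rpow_add ht, Nat.cast_sub hn]
    congr 1
    push_cast; ring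
  refine IntegrableOn.union ?_ ?_
  · have h : IntegrableOn (fun t : ℝ => t ^ (-α)) (Set.Ioc 0 1) := by
      rw [← intervalIntegrable_iff_integrableOn_Ioc_of_le zero_le_one]
      exact intervalIntegral.intervalIntegrable_rpow' (by linarith)
    refine h.congr_fun (fun t ht => ?_) measurableSet_Ioc
    have ht0 : 0 < t := ht.1
    simp only [smul_eq_mul, min_eq_left ht.2]
    rw [mul_left_comm, hpow t ht0]
    nth_rewrite 2 [← Real.rpow_one t]
    rw [← Real.rpow_add ht0]
    congr 1; ring
  · have h : IntegrableOn (fun t : ℝ => t ^ (-1 - α)) (Set.Ioi 1) :=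
      integrableOn_Ioi_rpow_of_lt (by linarith) one_pos
    refine h.congr_fun (fun t ht => ?_) measurableSet_Ioi
    have ht1 : (1 : ℝ) < t := ht
    simp only [smul_eq_mul, min_eq_right ht1.le, one_mul]
    rw [hpow t (by linarith)]

/-- The row-wise contraction of a matrix with a vector. -/
noncomputable def contr (m n : ℕ) : Mat m n →L[ℝ] Euc n →L[ℝ] Euc m :=
  (LinearMap.mk₂ ℝ
    (fun (M : Mat m n) (z : Euc n) => (WithLp.toLp 2 fun i => ∑ k, M (i, k) * z k : Euc m))
    (fun M N z => by ext i; simp [add_mul, Finset.sum_add_distrib])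
    (fun c M z => by ext i; simp [Finset.mul_sum, mul_assoc])
    (fun M z w => by ext i; simp [mul_add, Finset.sum_add_distrib])
    (fun c M z => by ext i; simp [Finset.mul_sum, mul_left_comm])).toContinuousBilinearMap

/-- The outer product of two vectors. -/
noncomputable def outer (m n : ℕ) : Euc m →L[ℝ] Euc n →L[ℝ] Mat m n :=
  (LinearMap.mk₂ ℝ
    (fun (u : Euc m) (z : Euc n) => (WithLp.toLp 2 fun p => u p.1 * z p.2 : Mat m n))
    (fun M N z => by ext i; simp [add_mul])
    (fun c M z => by ext i; simp [mul_assoc])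
    (fun M z w => by ext i; simp [mul_add])
    (fun c M z => by ext i; simp [mul_left_comm])).toContinuousBilinearMap

@[simp] lemma contr_apply {m n : ℕ} (M : Mat m n) (z : Euc n) (i : Fin m) :
    contr m n M z i = ∑ k, M (i, k) * z k := rfl

@[simp] lemma outer_apply {m n : ℕ} (u : Euc m) (z : Euc n) (p : Fin m × Fin n) :
    outer m n u z p = u p.1 * z p.2 := rfl

/-- Adjointness of the two bilinear maps; it moves the kernel from the test field onto u in the
Leibniz rule. -/
lemma inner_contr {m n : ℕ} (u : Euc m) (M : Mat m n) (z : Euc n) :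
    inner ℝ u (contr m n M z) = inner ℝ (outer m n u z) M := by
  simp only [PiLp.inner_apply, contr_apply, outer_apply, Fintype.sum_prod_type]
  refine Finset.sum_congr rfl fun i _ => ?_
  simp only [RCLike.inner_apply, conj_trivial, Finset.sum_mul]
  exact Finset.sum_congr rfl fun k _ => by ring

/-- `f` is bounded and Lipschitz, with a common constant `C`. -/
def BddLip {n : ℕ} {F : Type*} [NormedAddCommGroup F] (C : ℝ) (f : Euc n → F) : Prop :=
  0 ≤ C ∧ ∀ x z, ‖f (x + z) - f x‖ ≤ C * min ‖z‖ 1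

lemma IsTestFunction.exists_bddLip {n : ℕ} {F : Type*} [NormedAddCommGroup F] [NormedSpace ℝ F]
    {Ω : Set (Euc n)} {φ : Euc n → F} (hφ : IsTestFunction Ω φ) : ∃ C, BddLip C φ := by
  obtain ⟨K, hK⟩ := ContDiff.lipschitzWith_of_hasCompactSupport hφ.2.1 hφ.1 (by simp)
  obtain ⟨B, hB⟩ := hφ.2.1.exists_bound_of_continuous hφ.1.continuous
  have hB0 : 0 ≤ B := (norm_nonneg _).trans (hB 0)
  refine ⟨K + 2 * B, by positivity, fun x z => ?_⟩
  have h1 : ‖φ (x + z) - φ x‖ ≤ K * ‖z‖ := by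
    have := hK.dist_le_mul (x + z) x
    simpa [dist_eq_norm] using this
  have h2 : ‖φ (x + z) - φ x‖ ≤ 2 * B := by
    linarith [norm_sub_le (φ (x + z)) (φ x), hB (x + z), hB x]
  have hK0 := K.2
  rcases le_total ‖z‖ 1 with h | h
  · rw [min_eq_left h]
    calc _ ≤ _ := h1
      _ ≤ (K + 2 * B) * ‖z‖ := by gcongr; linarith
  · rw [min_eq_right h]
    have : (0 : ℝ) ≤ K := K.2
    linarith

section incr

variable {n m : ℕ} {α : ℝ}

/-- The integrand of the fractional divergence. -/
noncomputable def divIntegrand (α : ℝ) (φ : Euc n → Mat m n) (x z : Euc n) : Euc m :=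
  contr m n (φ (x + z) - φ x) (rieszKernel n α z)

lemma norm_divIntegrand_le {φ : Euc n → Mat m n} {C : ℝ} (hC : BddLip C φ) (x z : Euc n) :
    ‖divIntegrand α φ x z‖ ≤ ‖contr m n‖ * C * |rieszConst n α| * weight n α z := by
  have h1 := (contr m n).le_opNorm₂ (φ (x + z) - φ x) (rieszKernel n α z)
  have h2 := norm_rieszKernel_le n α z
  have hC0 := hC.1
  calc ‖divIntegrand α φ x z‖ ≤ ‖contr m n‖ * ‖φ (x + z) - φ x‖ * ‖rieszKernel n α z‖ := h1
    _ ≤ ‖contr m n‖ * (C * min ‖z‖ 1) * ‖rieszKernel n α z‖ := by gcongr; exact hC.2 x z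
    _ = ‖contr m n‖ * C * (min ‖z‖ 1 * ‖rieszKernel n α z‖) := by ring
    _ ≤ ‖contr m n‖ * C * (|rieszConst n α| * weight n α z) := by gcongr
    _ = _ := by ring

lemma measurable_divIntegrand {φ : Euc n → Mat m n} (hφ : Continuous φ) :
    Measurable (fun p : Euc n × Euc n => divIntegrand α φ p.1 p.2) := by
  have h1 : StronglyMeasurable (fun p : Euc n × Euc n => φ (p.1 + p.2) - φ p.1) := by
    have : Continuous (fun p : Euc n × Euc n => φ (p.1 + p.2) - φ p.1) := by fun_prop
    exact this.stronglyMeasurable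
  have h2 : StronglyMeasurable (fun p : Euc n × Euc n => rieszKernel n α p.2) :=
    ((measurable_rieszKernel n α).comp measurable_snd).stronglyMeasurable
  exact ((contr m n).continuous₂.comp_stronglyMeasurable (h1.prodMk h2)).measurable

variable (hn : 1 ≤ n) (hα₀ : 0 < α) (hα₁ : α < 1)
include hn hα₀ hα₁

lemma integrable_divIntegrand {φ : Euc n → Mat m n} (hφ : Continuous φ) {C : ℝ}
    (hC : BddLip C φ) (x : Euc n) : Integrable (divIntegrand α φ x) := by
  refine ((integrable_weight hn hα₀ hα₁).const_mul
    (‖contr m n‖ * C * |rieszConst n α|)).mono' ?_ (ae_of_all _ fun z => norm_divIntegrand_le hC x z)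
  exact ((measurable_divIntegrand hφ).comp measurable_prodMk_left).aestronglyMeasurable

/-- The substitution y = x + z turns the entrywise integrals into one Bochner integral of a
translation-invariant expression. Every later computation uses this form. -/
lemma fracDiv_eq {φ : Euc n → Mat m n} (hφ : Continuous φ) {C : ℝ} (hC : BddLip C φ) (x : Euc n) :
    fracDiv α φ x = ∫ z, divIntegrand α φ x z := by
  have hint := integrable_divIntegrand hn hα₀ hα₁ hφ hC x
  ext i
  have h1 := (EuclideanSpace.proj (𝕜 := ℝ) i : Euc m →L[ℝ] ℝ).integral_comp_comm hint
  simp only [EuclideanSpace.coe_proj] at h1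
  rw [← h1]
  simp only [fracDiv]
  rw [← integral_const_mul, ← integral_add_left_eq_self _ x]
  refine integral_congr_ae (ae_of_all _ fun z => ?_)
  simp only [divIntegrand, contr_apply, rieszKernel, Finset.mul_sum, PiLp.smul_apply, smul_eq_mul,
    PiLp.sub_apply, PiLp.add_apply, add_sub_cancel_left]
  refine Finset.sum_congr rfl fun k _ => ?_
  rw [div_eq_mul_inv, div_eq_mul_inv]
  ring

lemma norm_fracDiv_le {φ : Euc n → Mat m n} (hφ : Continuous φ) {C : ℝ} (hC : BddLip C φ)
    (x : Euc n) :
    ‖fracDiv α φ x‖ ≤ ‖contr m n‖ * C * |rieszConst n α| * ∫ z, weight n α z := by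
  rw [fracDiv_eq hn hα₀ hα₁ hφ hC, ← integral_const_mul]
  exact norm_integral_le_of_norm_le ((integrable_weight hn hα₀ hα₁).const_mul _)
    (ae_of_all _ fun z => norm_divIntegrand_le hC x z)

lemma aestronglyMeasurable_fracDiv {φ : Euc n → Mat m n} (hφ : Continuous φ) {C : ℝ}
    (hC : BddLip C φ) (τ : Measure (Euc n)) : AEStronglyMeasurable (fracDiv α φ) τ := by
  have : fracDiv α φ = fun x => ∫ z, divIntegrand α φ x z :=
    funext fun x => fracDiv_eq hn hα₀ hα₁ hφ hC x
  rw [this]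
  exact ((measurable_divIntegrand hφ).stronglyMeasurable.integral_prod_right
    (ν := volume)).aestronglyMeasurable

lemma integrable_inner_fracDiv {u : Euc n → Euc m} (hu : Integrable u)
    {φ : Euc n → Mat m n} (hφ : IsTestFunction Set.univ φ) :
    Integrable (fun x => inner ℝ (u x) (fracDiv α φ x)) := by
  obtain ⟨C, hC⟩ := hφ.exists_bddLip
  have hc := hφ.1.continuous
  refine (hu.norm.mul_const
    (‖contr m n‖ * C * |rieszConst n α| * ∫ z, weight n α z)).mono'
    (hu.aestronglyMeasurable.inner (aestronglyMeasurable_fracDiv hn hα₀ hα₁ hc hC _))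
    (ae_of_all _ fun x => ?_)
  refine (norm_inner_le_norm _ _).trans ?_
  gcongr
  exact norm_fracDiv_le hn hα₀ hα₁ hc hC x

lemma fracDiv_add {φ ψ : Euc n → Mat m n} (hφ : IsTestFunction Set.univ φ)
    (hψ : IsTestFunction Set.univ ψ) (x : Euc n) :
    fracDiv α (φ + ψ) x = fracDiv α φ x + fracDiv α ψ x := by
  obtain ⟨C, hC⟩ := hφ.exists_bddLip
  obtain ⟨D, hD⟩ := hψ.exists_bddLip
  have hCD : BddLip (C + D) (φ + ψ) := by
    refine ⟨add_nonneg hC.1 hD.1, fun x z => ?_⟩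
    have : (φ + ψ) (x + z) - (φ + ψ) x = (φ (x + z) - φ x) + (ψ (x + z) - ψ x) := by
      simp only [Pi.add_apply]; abel
    rw [this, add_mul]
    exact (norm_add_le _ _).trans (add_le_add (hC.2 x z) (hD.2 x z))
  have h1 := hφ.1.continuous
  have h2 := hψ.1.continuous
  rw [fracDiv_eq hn hα₀ hα₁ h1 hC, fracDiv_eq hn hα₀ hα₁ h2 hD,
    fracDiv_eq hn hα₀ hα₁ (h1.add h2) hCD, ← integral_add
      (integrable_divIntegrand hn hα₀ hα₁ h1 hC x) (integrable_divIntegrand hn hα₀ hα₁ h2 hD x)]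
  refine integral_congr_ae (ae_of_all _ fun z => ?_)
  simp only [divIntegrand, Pi.add_apply]
  rw [← add_apply, ← map_add]
  congr 2
  abel

end incr

/-- Scalars leave the integral without any integrability, so φ may be arbitrary here. -/
lemma fracDiv_smul {n m : ℕ} {α : ℝ} (c : ℝ) (φ : Euc n → Mat m n) (x : Euc n) :
    fracDiv α (c • φ) x = c • fracDiv α φ x := by
  ext i
  simp only [fracDiv, Pi.smul_apply, PiLp.smul_apply, smul_eq_mul]
  rw [mul_left_comm, ← integral_const_mul c]
  congr 2
  funext y
  rw [Finset.mul_sum]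
  refine Finset.sum_congr rfl fun k _ => ?_
  ring

end FractionalBV

/-! ### Fractional variations with a given decomposition, and the Leibniz rule -/

namespace FractionalBV

lemma IsTestFunction.integrable {n : ℕ} {F : Type*} [NormedAddCommGroup F] [NormedSpace ℝ F]
    {Ω : Set (Euc n)} {φ : Euc n → F} (hφ : IsTestFunction Ω φ) : Integrable φ :=
  hφ.1.continuous.integrable_of_hasCompactSupport hφ.2.1

lemma IsTestFunction.exists_bound {n : ℕ} {F : Type*} [NormedAddCommGroup F] [NormedSpace ℝ F]
    {Ω : Set (Euc n)} {φ : Euc n → F} (hφ : IsTestFunction Ω φ) : ∃ C, 0 ≤ C ∧ ∀ x, ‖φ x‖ ≤ C := by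
  obtain ⟨B, hB⟩ := hφ.2.1.exists_bound_of_continuous hφ.1.continuous
  exact ⟨B, (norm_nonneg _).trans (hB 0), hB⟩

lemma IsTestFunction.smul {n : ℕ} {F : Type*} [NormedAddCommGroup F] [NormedSpace ℝ F]
    {χ : Euc n → ℝ} {φ : Euc n → F} (hχ : ContDiff ℝ ∞ χ) (hφ : IsTestFunction Set.univ φ) :
    IsTestFunction Set.univ (fun x => χ x • φ x) :=
  ⟨hχ.smul hφ.1, hφ.2.1.smul_left, Set.subset_univ _⟩

lemma IsTestFunction.integrable_inner {n : ℕ} {F : Type*} [NormedAddCommGroup F]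
    [InnerProductSpace ℝ F] {Ω : Set (Euc n)} {φ : Euc n → F} (hφ : IsTestFunction Ω φ)
    {τ : Measure (Euc n)} {h : Euc n → F} (hh : Integrable h τ) :
    Integrable (fun x => inner ℝ (φ x) (h x)) τ := by
  obtain ⟨C, -, hC⟩ := hφ.exists_bound
  refine (hh.norm.const_mul C).mono'
    (hφ.1.continuous.aestronglyMeasurable.inner hh.aestronglyMeasurable) (ae_of_all _ fun x => ?_)
  exact (norm_inner_le_norm _ _).trans (by gcongr; exact hC x)

/-- The fractional variation of `u` is `a dx + h τ`. -/
structure HasVariation {n m : ℕ} (α : ℝ) (u : Euc n → Euc m) (a : Euc n → Mat m n)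
    (τ : Measure (Euc n)) (h : Euc n → Mat m n) : Prop where
  integrable : Integrable u
  integrable_ac : Integrable a
  integrable_sing : Integrable h τ
  integral_eq : ∀ φ : Euc n → Mat m n, IsTestFunction Set.univ φ →
    ∫ x, inner ℝ (u x) (fracDiv α φ x) =
      -((∫ x, inner ℝ (φ x) (a x)) + ∫ x, inner ℝ (φ x) (h x) ∂τ)

section leibniz

variable {n m : ℕ} {α : ℝ}

/-- The nonlocal correction term in the Leibniz rule for `D^α (χ u)`. -/
noncomputable def leibnizTerm (α : ℝ) (χ : Euc n → ℝ) (u : Euc n → Euc m) (y : Euc n) : Mat m n :=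
  ∫ x, (χ y - χ x) • outer m n (u x) (rieszKernel n α (y - x))

variable (hn : 1 ≤ n) (hα₀ : 0 < α) (hα₁ : α < 1)
include hn hα₀ hα₁

/-- The increment of χ tames the singularity of the kernel, so the integrand is dominated by a
multiple of the convolution integrand of ‖u‖ with `weight`. This gives both the integrability of
`leibnizTerm` and the Fubini exchange. -/
lemma integrable_leibniz_prod {χ : Euc n → ℝ} (hχ : Continuous χ) {C : ℝ} (hC : BddLip C χ)
    {u : Euc n → Euc m} (hu : Integrable u) :
    Integrable (fun p : Euc n × Euc n =>
      (χ p.1 - χ p.2) • outer m n (u p.2) (rieszKernel n α (p.1 - p.2)))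
      (volume.prod volume) := by
  have hW := integrable_weight hn hα₀ hα₁
  have h1 : Integrable (fun p : Euc n × Euc n => ‖u p.2‖ * weight n α (p.1 - p.2))
      (volume.prod volume) := by
    have := hu.norm.convolution_integrand (ContinuousLinearMap.mul ℝ ℝ) hW
    simpa using this
  refine (h1.const_mul (‖outer m n‖ * C * |rieszConst n α|)).mono' ?_ (ae_of_all _ fun p => ?_)
  · have hK : AEStronglyMeasurable (fun p : Euc n × Euc n => rieszKernel n α (p.1 - p.2))
        (volume.prod volume) :=
      ((measurable_rieszKernel n α).comp (measurable_fst.sub measurable_snd)).aestronglyMeasurable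
    have hu2 : AEStronglyMeasurable (fun p : Euc n × Euc n => u p.2) (volume.prod volume) :=
      hu.aestronglyMeasurable.comp_snd
    have h3 : Continuous (fun p : Euc n × Euc n => χ p.1 - χ p.2) := by fun_prop
    exact h3.aestronglyMeasurable.smul
      ((outer m n).aestronglyMeasurable_comp₂ hu2 hK)
  · have hC0 := hC.1
    have h2 := hC.2 p.2 (p.1 - p.2)
    rw [add_sub_cancel] at h2
    rw [norm_smul]
    calc ‖χ p.1 - χ p.2‖ * ‖outer m n (u p.2) (rieszKernel n α (p.1 - p.2))‖
        ≤ (C * min ‖p.1 - p.2‖ 1) * (‖outer m n‖ * ‖u p.2‖ * ‖rieszKernel n α (p.1 - p.2)‖) := by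
          gcongr
          exact (outer m n).le_opNorm₂ _ _
      _ = (‖outer m n‖ * C * ‖u p.2‖) * (min ‖p.1 - p.2‖ 1 * ‖rieszKernel n α (p.1 - p.2)‖) := by
          ring
      _ ≤ (‖outer m n‖ * C * ‖u p.2‖) * (|rieszConst n α| * weight n α (p.1 - p.2)) := by
          exact mul_le_mul_of_nonneg_left (norm_rieszKernel_le n α _) (by positivity)
      _ = _ := by ring

lemma integrable_leibnizTerm {χ : Euc n → ℝ} (hχ : Continuous χ) {C : ℝ} (hC : BddLip C χ)
    {u : Euc n → Euc m} (hu : Integrable u) : Integrable (leibnizTerm α χ u) :=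
  (integrable_leibniz_prod hn hα₀ hα₁ hχ hC hu).integral_prod_left

/-- Pointwise form of the Leibniz rule, from χ(x)(φ(x+z) - φ(x)) = ((χφ)(x+z) - (χφ)(x)) - (χ(x+z) -
χ(x)) φ(x+z). Each of the two differences of products is integrable against the kernel, hence so is
the correction. -/
lemma inner_smul_fracDiv {χ : Euc n → ℝ} (hχ : ContDiff ℝ ∞ χ)
    {φ : Euc n → Mat m n} (hφ : IsTestFunction Set.univ φ) (v : Euc m) (x : Euc n) :
    inner ℝ (χ x • v) (fracDiv α φ x) = inner ℝ v (fracDiv α (fun y => χ y • φ y) x) -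
      ∫ y, inner ℝ ((χ y - χ x) • outer m n v (rieszKernel n α (y - x))) (φ y) := by
  obtain ⟨D, hD⟩ := hφ.exists_bddLip
  have hχφ := hφ.smul hχ
  obtain ⟨D', hD'⟩ := hχφ.exists_bddLip
  have i1 := integrable_divIntegrand hn hα₀ hα₁ hφ.1.continuous hD x
  have i2 := integrable_divIntegrand hn hα₀ hα₁ hχφ.1.continuous hD' x
  rw [fracDiv_eq hn hα₀ hα₁ hφ.1.continuous hD, fracDiv_eq hn hα₀ hα₁ hχφ.1.continuous hD',
    ← integral_inner i1, ← integral_inner i2,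
    ← integral_add_left_eq_self (fun y => inner ℝ ((χ y - χ x) • outer m n v _) (φ y)) x,
    eq_sub_iff_add_eq]
  have key : ∀ z, inner ℝ ((χ (x + z) - χ x) • outer m n v (rieszKernel n α (x + z - x)))
      (φ (x + z)) = inner ℝ v (divIntegrand α (fun y => χ y • φ y) x z) -
        inner ℝ (χ x • v) (divIntegrand α φ x z) := by
    intro z
    simp only [divIntegrand, add_sub_cancel_left, map_sub, sub_apply, map_smul,
      smul_apply, inner_sub_right, inner_smul_left, inner_smul_right, inner_contr]
    simp
    ring
  have i3 : Integrable fun z => inner ℝ v (divIntegrand α (fun y => χ y • φ y) x z) :=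
    i2.const_inner v
  have i4 : Integrable fun z => inner ℝ (χ x • v) (divIntegrand α φ x z) := i1.const_inner _
  simp_rw [key]
  rw [integral_sub i3 i4]
  ring

/-- The Leibniz rule for the fractional variation. -/
lemma HasVariation.smul {u : Euc n → Euc m} {a h : Euc n → Mat m n} {τ : Measure (Euc n)}
    (H : HasVariation α u a τ h) {χ : Euc n → ℝ} (hχ : IsTestFunction Set.univ χ) :
    HasVariation α (fun x => χ x • u x) (fun x => χ x • a x + leibnizTerm α χ u x) τ
      (fun x => χ x • h x) := by
  obtain ⟨C, hC⟩ := hχ.exists_bddLip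
  obtain ⟨B, hB0, hB⟩ := hχ.exists_bound
  have hχc := hχ.1.continuous
  have hsm : ∀ {F : Type} [NormedAddCommGroup F] [NormedSpace ℝ F] {ν : Measure (Euc n)}
      {f : Euc n → F}, Integrable f ν → Integrable (fun x => χ x • f x) ν := by
    intro F _ _ ν f hf
    exact hf.bdd_smul B hχc.aestronglyMeasurable (ae_of_all _ hB)
  have hf := integrable_leibnizTerm hn hα₀ hα₁ hχc hC H.integrable
  refine ⟨hsm H.integrable, (hsm H.integrable_ac).add hf, hsm H.integrable_sing, fun φ hφ => ?_⟩
  have hχφ := hφ.smul hχ.1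
  have hprod := integrable_leibniz_prod hn hα₀ hα₁ hχc hC H.integrable
  obtain ⟨D, hD0, hD⟩ := hφ.exists_bound
  have hprod' : Integrable (fun p : Euc n × Euc n => inner ℝ
      ((χ p.1 - χ p.2) • outer m n (u p.2) (rieszKernel n α (p.1 - p.2))) (φ p.1))
      (volume.prod volume) := by
    have hc : Continuous fun p : Euc n × Euc n => φ p.1 := hφ.1.continuous.comp continuous_fst
    refine (hprod.norm.mul_const D).mono'
      (hprod.aestronglyMeasurable.inner hc.aestronglyMeasurable) (ae_of_all _ fun p => ?_)
    exact (norm_inner_le_norm _ _).trans (by gcongr; exact hD _)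
  simp_rw [inner_smul_fracDiv hn hα₀ hα₁ hχ.1 hφ]
  -- Apply the defining identity of u to the test field χφ; exchanging the order of integration in
  -- the correction exhibits `leibnizTerm` as a density.
  rw [integral_sub (integrable_inner_fracDiv hn hα₀ hα₁ H.integrable hχφ)
    hprod'.integral_prod_right, H.integral_eq _ hχφ,
    ← integral_integral_swap (f := fun y x => inner ℝ
      ((χ y - χ x) • outer m n (u x) (rieszKernel n α (y - x))) (φ y)) hprod']
  have e1 : ∫ y, ∫ x, inner ℝ ((χ y - χ x) • outer m n (u x) (rieszKernel n α (y - x))) (φ y) =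
      ∫ y, inner ℝ (φ y) (leibnizTerm α χ u y) := by
    refine integral_congr_ae ?_
    filter_upwards [hprod.prod_right_ae] with y hy
    rw [leibnizTerm, ← integral_inner hy]
    exact integral_congr_ae (ae_of_all _ fun x => real_inner_comm _ _)
  have e2 : ∫ y, inner ℝ (φ y) (χ y • a y + leibnizTerm α χ u y) =
      (∫ y, inner ℝ (χ y • φ y) (a y)) + ∫ y, inner ℝ (φ y) (leibnizTerm α χ u y) := by
    rw [← integral_add (hχφ.integrable_inner H.integrable_ac) (hφ.integrable_inner hf)]
    refine integral_congr_ae (ae_of_all _ fun y => ?_)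
    simp only [inner_add_right, inner_smul_left, inner_smul_right]
    simp
  have e3 : ∫ y, inner ℝ (φ y) (χ y • h y) ∂τ = ∫ y, inner ℝ (χ y • φ y) (h y) ∂τ := by
    refine integral_congr_ae (ae_of_all _ fun y => ?_)
    simp only [inner_smul_left, inner_smul_right]
    simp
  rw [e1, e2, e3]
  ring

end leibniz

end FractionalBV

/-! ### Mollification of functions and measures -/

namespace FractionalBV

/-- The convolution `η * (h τ)` of a kernel with the measure of density `h` with respect to `τ`. -/
noncomputable def smear {n : ℕ} {F : Type*} [NormedAddCommGroup F] [NormedSpace ℝ F]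
    (η : Euc n → ℝ) (τ : Measure (Euc n)) (h : Euc n → F) (x : Euc n) : F :=
  ∫ y, η (x - y) • h y ∂τ

/-- A smooth mollifier supported in the closed ball of radius `δ` around the origin. -/
structure IsMollifier {n : ℕ} (δ : ℝ) (η : Euc n → ℝ) : Prop where
  test : IsTestFunction Set.univ η
  nonneg : ∀ z, 0 ≤ η z
  integral_eq_one : ∫ z, η z = 1
  norm_le : ∀ z, η z ≠ 0 → ‖z‖ ≤ δ

section smear

variable {n : ℕ} {F : Type*} [NormedAddCommGroup F]

section normed

variable [NormedSpace ℝ F] {η : Euc n → ℝ} {τ : Measure (Euc n)} {h : Euc n → F}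

lemma integrable_smear_prod [SFinite τ] (hη : IsTestFunction Set.univ η) (hh : Integrable h τ) :
    Integrable (fun p : Euc n × Euc n => η (p.1 - p.2) • h p.2) ((volume : Measure (Euc n)).prod τ) := by
  have hc : Continuous fun p : Euc n × Euc n => η (p.1 - p.2) :=
    hη.1.continuous.comp (continuous_fst.sub continuous_snd)
  have hm : AEStronglyMeasurable (fun p : Euc n × Euc n => η (p.1 - p.2) • h p.2)
      ((volume : Measure (Euc n)).prod τ) :=
    hc.aestronglyMeasurable.smul hh.aestronglyMeasurable.comp_snd
  rw [integrable_prod_iff' hm]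
  refine ⟨ae_of_all _ fun y => (hη.integrable.comp_sub_right y).smul_const (h y), ?_⟩
  simp only [norm_smul, integral_mul_const]
  refine (hh.norm.const_mul (∫ x, ‖η x‖)).congr (ae_of_all _ fun y => ?_)
  simp only
  rw [integral_sub_right_eq_self (fun x => ‖η x‖) y]

lemma integrable_smear [SFinite τ] (hη : IsTestFunction Set.univ η) (hh : Integrable h τ) :
    Integrable (smear η τ h) :=
  (integrable_smear_prod hη hh).integral_prod_left

lemma integral_norm_smear_le [SFinite τ] {δ : ℝ} (hη : IsMollifier δ η) (hh : Integrable h τ) :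
    ∫ x, ‖smear η τ h x‖ ≤ ∫ y, ‖h y‖ ∂τ := by
  have hp := integrable_smear_prod hη.test hh
  calc ∫ x, ‖smear η τ h x‖ ≤ ∫ x, ∫ y, ‖η (x - y) • h y‖ ∂τ :=
        integral_mono (integrable_smear hη.test hh).norm hp.norm.integral_prod_left
          fun x => norm_integral_le_integral_norm _
    _ = ∫ y, (∫ x, ‖η (x - y) • h y‖) ∂τ :=
        integral_integral_swap (f := fun x y => ‖η (x - y) • h y‖) hp.norm
    _ = ∫ y, ‖h y‖ ∂τ := by
        refine integral_congr_ae (ae_of_all _ fun y => ?_)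
        simp only [norm_smul, integral_mul_const, Real.norm_of_nonneg (hη.nonneg _)]
        rw [integral_sub_right_eq_self η y, hη.integral_eq_one, one_mul]

lemma smear_eq_convolution (η : Euc n → ℝ) (f : Euc n → F) :
    smear η volume f = convolution f η (ContinuousLinearMap.lsmul ℝ ℝ).flip volume := by
  ext x
  simp [smear, convolution]

lemma smear_volume_eq (η : Euc n → ℝ) (f : Euc n → F) (x : Euc n) :
    smear η volume f x = ∫ z, η z • f (x - z) := by
  unfold smear
  rw [← integral_sub_left_eq_self (fun y => η (x - y) • f y) volume x]
  simp

lemma contDiff_smear [CompleteSpace F] (hη : IsTestFunction Set.univ η) {f : Euc n → F}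
    (hf : Integrable f) : ContDiff ℝ ∞ (smear η volume f) := by
  rw [smear_eq_convolution]
  exact hη.2.1.contDiff_convolution_right _ hf.locallyIntegrable hη.1

/-- The correlation of a kernel with a function; this is the adjoint of `smear`. -/
noncomputable def corr (η : Euc n → ℝ) (φ : Euc n → F) (y : Euc n) : F :=
  ∫ z, η z • φ (y + z)

lemma corr_eq (η : Euc n → ℝ) (φ : Euc n → F) (y : Euc n) :
    corr η φ y = ∫ x, η (x - y) • φ x := by
  unfold corr
  rw [← integral_add_left_eq_self (fun x => η (x - y) • φ x) y]
  simp

lemma isTestFunction_neg (hη : IsTestFunction Set.univ η) :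
    IsTestFunction Set.univ (fun z => η (-z)) :=
  ⟨hη.1.comp contDiff_neg, hη.2.1.comp_homeomorph (Homeomorph.neg _), Set.subset_univ _⟩

lemma isTestFunction_corr [CompleteSpace F] (hη : IsTestFunction Set.univ η) {φ : Euc n → F}
    (hφ : IsTestFunction Set.univ φ) : IsTestFunction Set.univ (corr η φ) := by
  have hη' := isTestFunction_neg hη
  have e : corr η φ = smear (fun z => η (-z)) volume φ := by
    ext y
    rw [corr_eq]
    simp [smear]
  rw [e]
  refine ⟨contDiff_smear hη' hφ.integrable, ?_, Set.subset_univ _⟩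
  rw [smear_eq_convolution]
  exact hφ.2.1.convolution _ hη'.2.1

/-- The estimate depends on the mollifier only through its radius, so the mollifiers need be neither
centred nor rescalings of one profile. Approximate f in L¹ by a compactly supported continuous g;
uniform continuity treats g, and contractivity of mollification in L¹ treats f - g. -/
lemma exists_smear_sub_le [CompleteSpace F] {f : Euc n → F} (hf : Integrable f) {ε : ℝ}
    (hε : 0 < ε) : ∃ δ > 0, ∀ η, IsMollifier δ η → ∫ x, ‖smear η volume f x - f x‖ ≤ ε := by
  obtain ⟨g, hgs, hfg, hgc, hgi⟩ := hf.exists_hasCompactSupport_integral_sub_le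
    (show (0 : ℝ) < ε / 3 by positivity)
  set K : Set (Euc n) := Metric.cthickening 1 (tsupport g) with hKdef
  have hK : IsCompact K := hgs.isCompact.cthickening
  set V : ℝ := volume.real K with hV
  have hV0 : 0 ≤ V := measureReal_nonneg
  have hunif : UniformContinuous g := hgs.uniformContinuous_of_continuous hgc
  obtain ⟨δ, hδ, hgδ⟩ := Metric.uniformContinuous_iff.1 hunif (ε / (3 * (V + 1))) (by positivity)
  -- The bound 1 keeps the support of the mollified g in K; δ / 2 makes the distance strictly less
  -- than δ.
  refine ⟨min (δ / 2) 1, by positivity, fun η hη => ?_⟩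
  have hsg := integrable_smear hη.test hgi
  have hsf := integrable_smear hη.test hf
  have hd := hf.sub hgi
  have hsd := integrable_smear hη.test hd
  have hηg : ∀ x, Integrable fun z => η z • g (x - z) := fun x => by
    refine (Continuous.integrable_of_hasCompactSupport (by
      have := hη.test.1.continuous
      fun_prop) ?_)
    exact hη.test.2.1.smul_right
  have hpt : ∀ x, ‖smear η volume g x - g x‖ ≤ K.indicator (fun _ => ε / (3 * (V + 1))) x := by
    intro x
    have e1 : smear η volume g x - g x = ∫ z, η z • (g (x - z) - g x) := by
      simp only [smul_sub]
      rw [integral_sub (hηg x) (hη.test.integrable.smul_const _), integral_smul_const,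
        hη.integral_eq_one, one_smul, smear_volume_eq]
    rw [e1]
    by_cases hx : x ∈ K
    · rw [Set.indicator_of_mem hx]
      have : ∫ z, η z * (ε / (3 * (V + 1))) = ε / (3 * (V + 1)) := by
        rw [integral_mul_const, hη.integral_eq_one, one_mul]
      rw [← this]
      refine norm_integral_le_of_norm_le (hη.test.integrable.mul_const _) (ae_of_all _ fun z => ?_)
      rw [norm_smul, Real.norm_of_nonneg (hη.nonneg z)]
      rcases eq_or_ne (η z) 0 with hz | hz
      · simp [hz]
      · have hzδ := hη.norm_le z hz
        refine mul_le_mul_of_nonneg_left ?_ (hη.nonneg z)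
        rw [← dist_eq_norm]
        refine (hgδ ?_).le
        rw [dist_eq_norm]
        simp only [sub_sub_cancel_left, norm_neg]
        linarith [min_le_left (δ / 2) 1]
    · rw [Set.indicator_of_notMem hx]
      refine (norm_le_zero_iff.2 ?_)
      refine integral_eq_zero_of_ae (ae_of_all _ fun z => ?_)
      rcases eq_or_ne (η z) 0 with hz | hz
      · simp [hz]
      · have hzδ := (hη.norm_le z hz).trans (min_le_right _ _)
        have h1 : g x = 0 := by
          by_contra hne
          exact hx (Metric.self_subset_cthickening _ (subset_tsupport _ hne))
        have h2 : g (x - z) = 0 := by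
          by_contra hne
          refine hx (Metric.mem_cthickening_of_dist_le x (x - z) 1 _ (subset_tsupport _ hne) ?_)
          simpa [dist_eq_norm] using hzδ
        simp [h1, h2]
  have hind : Integrable (K.indicator fun _ => ε / (3 * (V + 1))) :=
    (integrable_indicator_iff hK.measurableSet).2
      (integrableOn_const (hK.measure_lt_top.ne))
  have h3 : ∫ x, ‖smear η volume g x - g x‖ ≤ ε / 3 := by
    calc _ ≤ ∫ x, K.indicator (fun _ => ε / (3 * (V + 1))) x :=
          integral_mono (hsg.sub hgi).norm hind hpt
      _ = V * (ε / (3 * (V + 1))) := by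
          rw [integral_indicator hK.measurableSet, setIntegral_const, smul_eq_mul]
      _ ≤ ε / 3 := by
          rw [mul_div_assoc', div_le_div_iff₀ (by positivity) (by positivity)]
          nlinarith
  have hsplit : smear η volume (f - g) =ᵐ[volume] smear η volume f - smear η volume g := by
    filter_upwards [(integrable_smear_prod hη.test hf).prod_right_ae,
      (integrable_smear_prod hη.test hgi).prod_right_ae] with x h1 h2
    simp only [smear, Pi.sub_apply, smul_sub]
    exact integral_sub h1 h2
  calc ∫ x, ‖smear η volume f x - f x‖
      ≤ ∫ x, ‖smear η volume (f - g) x‖ + ‖smear η volume g x - g x‖ + ‖(f - g) x‖ := by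
        refine integral_mono_ae (hsf.sub hf).norm
          ((hsd.norm.add (hsg.sub hgi).norm).add hd.norm) ?_
        filter_upwards [hsplit] with x hx
        rw [hx]
        have : smear η volume f x - f x = (smear η volume f - smear η volume g) x +
          (smear η volume g x - g x) - (f - g) x := by simp only [Pi.sub_apply]; abel
        rw [this]
        exact (norm_sub_le _ _).trans (add_le_add_left (norm_add_le _ _) _)
    _ = (∫ x, ‖smear η volume (f - g) x‖) + (∫ x, ‖smear η volume g x - g x‖) +
        ∫ x, ‖(f - g) x‖ := by
        have hsgd : Integrable fun x => ‖smear η volume g x - g x‖ := (hsg.sub hgi).norm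
        have hadd : Integrable fun x => ‖smear η volume (f - g) x‖ + ‖smear η volume g x - g x‖ :=
          hsd.norm.add hsgd
        rw [integral_add hadd hd.norm, integral_add hsd.norm hsgd]
    _ ≤ ε / 3 + ε / 3 + ε / 3 :=
        add_le_add (add_le_add ((integral_norm_smear_le hη hd).trans hfg) h3) hfg
    _ = ε := by ring

end normed

/-- Fubini. The field ψ need only be measurable and bounded, since it is also applied to the
fractional divergence of a test field, which need not have compact support. -/
lemma integral_inner_smear [InnerProductSpace ℝ F] [CompleteSpace F] {η : Euc n → ℝ}
    {τ : Measure (Euc n)} [SFinite τ]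
    {h : Euc n → F} (hη : IsTestFunction Set.univ η) (hh : Integrable h τ) {ψ : Euc n → F}
    (hψ : AEStronglyMeasurable ψ) {C : ℝ} (hC : ∀ x, ‖ψ x‖ ≤ C) :
    ∫ x, inner ℝ (ψ x) (smear η τ h x) = ∫ y, inner ℝ (corr η ψ y) (h y) ∂τ := by
  have hp := integrable_smear_prod hη hh
  have hpi : Integrable (fun p : Euc n × Euc n => inner ℝ (ψ p.1) (η (p.1 - p.2) • h p.2))
      ((volume : Measure (Euc n)).prod τ) := by
    refine (hp.norm.const_mul C).mono' (hψ.comp_fst.inner hp.aestronglyMeasurable)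
      (ae_of_all _ fun p => ?_)
    exact (norm_inner_le_norm _ _).trans (by gcongr; exact hC _)
  have e1 : ∫ x, inner ℝ (ψ x) (smear η τ h x) =
      ∫ x, ∫ y, inner ℝ (ψ x) (η (x - y) • h y) ∂τ := by
    refine integral_congr_ae ?_
    filter_upwards [hp.prod_right_ae] with x hx
    exact (integral_inner hx _).symm
  rw [e1, integral_integral_swap hpi]
  refine integral_congr_ae (ae_of_all _ fun y => ?_)
  have hi : Integrable fun x => η (x - y) • ψ x :=
    (hη.integrable.comp_sub_right y).smul_bdd C hψ (ae_of_all _ hC)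
  simp only
  rw [corr_eq, real_inner_comm, ← integral_inner hi]
  refine integral_congr_ae (ae_of_all _ fun x => ?_)
  simp only [inner_smul_right]
  rw [real_inner_comm]

end smear

section mollify

variable {n m : ℕ} {α : ℝ} (hn : 1 ≤ n) (hα₀ : 0 < α) (hα₁ : α < 1)
include hn hα₀ hα₁

/-- A correlation averages translates, and the fractional divergence commutes with translations; the
product bound |η| times `weight` justifies the exchange of integrals. -/
lemma fracDiv_corr {η : Euc n → ℝ} (hη : IsTestFunction Set.univ η) {φ : Euc n → Mat m n}
    (hφ : IsTestFunction Set.univ φ) (y : Euc n) :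
    fracDiv α (corr η φ) y = corr η (fracDiv α φ) y := by
  obtain ⟨C, hC⟩ := hφ.exists_bddLip
  have hcφ := isTestFunction_corr hη hφ
  obtain ⟨D, hD⟩ := hcφ.exists_bddLip
  rw [fracDiv_eq hn hα₀ hα₁ hcφ.1.continuous hD]
  simp only [corr, fracDiv_eq hn hα₀ hα₁ hφ.1.continuous hC]
  have hW := integrable_weight hn hα₀ hα₁
  have hηφ : ∀ w, Integrable fun z => η z • φ (w + z) := fun w =>
    Continuous.integrable_of_hasCompactSupport (by
      have := hη.1.continuous
      have := hφ.1.continuous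
      fun_prop) hη.2.1.smul_right
  have hprod : Integrable (fun p : Euc n × Euc n => η p.1 • divIntegrand α φ (y + p.1) p.2)
      (volume.prod volume) := by
    refine ((hη.integrable.norm.mul_prod hW).const_mul
      (‖contr m n‖ * C * |rieszConst n α|)).mono' ?_ (ae_of_all _ fun p => ?_)
    · have h1 : Continuous fun p : Euc n × Euc n => η p.1 := hη.1.continuous.comp continuous_fst
      have h2 : Measurable fun p : Euc n × Euc n => (y + p.1, p.2) := by fun_prop
      exact h1.aestronglyMeasurable.smul
        ((measurable_divIntegrand hφ.1.continuous).comp h2).aestronglyMeasurable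
    · rw [norm_smul]
      have := norm_divIntegrand_le (α := α) hC (y + p.1) p.2
      calc _ ≤ ‖η p.1‖ * (‖contr m n‖ * C * |rieszConst n α| * weight n α p.2) := by gcongr
        _ = _ := by ring
  have hswap := integral_integral_swap (f := fun z w => η z • divIntegrand α φ (y + z) w) hprod
  simp only [integral_smul] at hswap
  rw [hswap]
  refine integral_congr_ae (ae_of_all _ fun w => ?_)
  simp only [divIntegrand, corr]
  rw [← integral_sub (hηφ _) (hηφ _)]
  have hi : Integrable fun z => η z • φ (y + w + z) - η z • φ (y + z) := (hηφ _).sub (hηφ _)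
  have := ((contr m n).flip (rieszKernel n α w)).integral_comp_comm hi
  simp only [ContinuousLinearMap.flip_apply] at this
  rw [← this]
  refine integral_congr_ae (ae_of_all _ fun z => ?_)
  simp only [← smul_sub, map_smul, smul_apply]
  rw [add_right_comm]

/-- Mollification of a function mollifies its fractional variation. -/
lemma HasVariation.smear {u : Euc n → Euc m} {a h : Euc n → Mat m n} {τ : Measure (Euc n)}
    [SFinite τ] (H : HasVariation α u a τ h) {η : Euc n → ℝ} (hη : IsTestFunction Set.univ η) :
    HasVariation α (smear η volume u) (smear η volume a + smear η τ h) τ 0 := by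
  refine ⟨integrable_smear hη H.integrable, (integrable_smear hη H.integrable_ac).add
    (integrable_smear hη H.integrable_sing), integrable_zero _ _ _, fun φ hφ => ?_⟩
  obtain ⟨C, hC⟩ := hφ.exists_bddLip
  obtain ⟨D, hD0, hD⟩ := hφ.exists_bound
  have hcφ := isTestFunction_corr hη hφ
  have h1 := integral_inner_smear hη H.integrable
    (aestronglyMeasurable_fracDiv hn hα₀ hα₁ hφ.1.continuous hC _)
    (norm_fracDiv_le hn hα₀ hα₁ hφ.1.continuous hC)
  have h2 := integral_inner_smear hη H.integrable_ac hφ.1.continuous.aestronglyMeasurable hD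
  have h3 := integral_inner_smear hη H.integrable_sing hφ.1.continuous.aestronglyMeasurable hD
  have h4 : ∫ x, inner ℝ (FractionalBV.smear η volume u x) (fracDiv α φ x) =
      ∫ y, inner ℝ (u y) (fracDiv α (corr η φ) y) := by
    simp_rw [fracDiv_corr hn hα₀ hα₁ hη hφ]
    simp_rw [real_inner_comm] at h1 ⊢
    exact h1
  rw [h4, H.integral_eq _ hcφ, ← h2, ← h3]
  simp only [Pi.zero_apply, inner_zero_right, integral_zero, add_zero, Pi.add_apply,
    inner_add_right]
  rw [integral_add (hφ.integrable_inner (integrable_smear hη H.integrable_ac))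
    (hφ.integrable_inner (integrable_smear hη H.integrable_sing))]

lemma HasVariation.add {u v : Euc n → Euc m} {a b h k : Euc n → Mat m n} {τ : Measure (Euc n)}
    (H : HasVariation α u a τ h) (H' : HasVariation α v b τ k) :
    HasVariation α (u + v) (a + b) τ (h + k) := by
  refine ⟨H.1.add H'.1, H.2.add H'.2, H.3.add H'.3, fun φ hφ => ?_⟩
  simp only [Pi.add_apply, inner_add_left, inner_add_right]
  rw [integral_add (integrable_inner_fracDiv hn hα₀ hα₁ H.1 hφ)
    (integrable_inner_fracDiv hn hα₀ hα₁ H'.1 hφ), integral_add (hφ.integrable_inner H.2)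
    (hφ.integrable_inner H'.2), integral_add (hφ.integrable_inner H.3)
    (hφ.integrable_inner H'.3), H.4 φ hφ, H'.4 φ hφ]
  ring

/-- A common τ for all summands is what makes the singular densities addable; the pieces χ_i w share
the τ of w. -/
lemma HasVariation.sum {ι : Type*} (s : Finset ι) {u : ι → Euc n → Euc m}
    {a h : ι → Euc n → Mat m n} {τ : Measure (Euc n)}
    (H : ∀ i ∈ s, HasVariation α (u i) (a i) τ (h i)) :
    HasVariation α (∑ i ∈ s, u i) (∑ i ∈ s, a i) τ (∑ i ∈ s, h i) := by
  classical
  induction s using Finset.induction_on with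
  | empty =>
    refine ⟨integrable_zero _ _ _, integrable_zero _ _ _, integrable_zero _ _ _, fun φ _ => ?_⟩
    simp
  | insert i s hi ih =>
    rw [Finset.sum_insert hi, Finset.sum_insert hi, Finset.sum_insert hi]
    exact (H i (Finset.mem_insert_self _ _)).add hn hα₀ hα₁
      (ih fun j hj => H j (Finset.mem_insert_of_mem hj))

end mollify

end FractionalBV

/-! ### Matrix-valued measures: densities, integrals, uniqueness of D^α u and its decomposition -/

namespace FractionalBV

lemma absolutelyContinuous_totalVariation {X : Type*} [MeasurableSpace X] (s : SignedMeasure X)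
    {T : Measure X} (h : s.totalVariation ≤ T) : s ≪ᵥ T.toENNRealVectorMeasure := by
  rw [SignedMeasure.absolutelyContinuous_ennreal_iff]
  refine Measure.AbsolutelyContinuous.trans h.absolutelyContinuous ?_
  have : T.toENNRealVectorMeasure.ennrealToMeasure = T := by
    ext i hi
    rw [VectorMeasure.ennrealToMeasure_apply hi, Measure.toENNRealVectorMeasure_apply_measurable hi]
  rw [this]

section matrix

variable {n m : ℕ}

lemma entry_apply (μ : VectorMeasure (Euc n) (Mat m n)) (p : Fin m × Fin n) (s : Set (Euc n)) :
    entry μ p s = μ s p := rfl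

/-- Every matrix-valued measure has an integrable density with respect to a finite measure. -/
lemma exists_eq_withDensity (μ : VectorMeasure (Euc n) (Mat m n)) :
    ∃ (T : Measure (Euc n)) (g : Euc n → Mat m n), IsFiniteMeasure T ∧ Integrable g T ∧
      μ = T.withDensityᵥ g := by
  set T : Measure (Euc n) := ∑ p, (entry μ p).totalVariation with hT
  have hfin : ∀ p, IsFiniteMeasure (entry μ p).totalVariation := fun p => by
    unfold SignedMeasure.totalVariation; infer_instance
  have hTfin : IsFiniteMeasure T := by
    refine ⟨?_⟩
    rw [hT, Measure.finsetSum_apply]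
    exact ENNReal.sum_lt_top.2 fun p _ => measure_lt_top _ _
  have hle : ∀ p, (entry μ p).totalVariation ≤ T := fun p =>
    Finset.single_le_sum (f := fun p => (entry μ p).totalVariation)
      (fun _ _ => Measure.zero_le _) (Finset.mem_univ p)
  have hint : Integrable (fun x => (WithLp.toLp 2 fun p => (entry μ p).rnDeriv T x : Mat m n)) T :=
    Integrable.of_eval_piLp fun p => SignedMeasure.integrable_rnDeriv _ _
  refine ⟨T, _, hTfin, hint, ?_⟩
  ext s hs p
  rw [withDensityᵥ_apply hint hs]
  have h1 := (EuclideanSpace.proj (𝕜 := ℝ) p : Mat m n →L[ℝ] ℝ).integral_comp_comm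
    hint.integrableOn (μ := T.restrict s)
  simp only [EuclideanSpace.coe_proj] at h1
  rw [← h1, ← entry_apply, ← withDensityᵥ_apply (SignedMeasure.integrable_rnDeriv _ _) hs,
    SignedMeasure.withDensityᵥ_rnDeriv_eq _ _ (absolutelyContinuous_totalVariation _ (hle p))]

lemma integrable_withDensity_variation {T : Measure (Euc n)} {g : Euc n → Mat m n}
    (hg : Integrable g T) : IsFiniteMeasure (T.withDensityᵥ g).variation := by
  rw [Measure.variation_withDensityᵥ hg]
  exact ⟨by simpa using! hg.2⟩

lemma isFiniteMeasure_variation (μ : VectorMeasure (Euc n) (Mat m n)) :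
    IsFiniteMeasure μ.variation := by
  obtain ⟨T, g, -, hg, rfl⟩ := exists_eq_withDensity μ
  exact integrable_withDensity_variation hg

lemma IsTestFunction.integrable_variation {φ : Euc n → Mat m n} {Ω : Set (Euc n)}
    (hφ : IsTestFunction Ω φ) (μ : VectorMeasure (Euc n) (Mat m n)) : μ.Integrable φ := by
  have := isFiniteMeasure_variation μ
  exact hφ.1.continuous.integrable_of_hasCompactSupport hφ.2.1

/-- With θ = g / ‖g‖ the right-hand side becomes an integral against the variation measure. Both
sides are then continuous in φ for the L¹ norm of the variation, so agreement on indicators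
suffices. -/
lemma integral_withDensity {T : Measure (Euc n)} {g : Euc n → Mat m n}
    (hg : Integrable g T) {φ : Euc n → Mat m n} (hφ : (T.withDensityᵥ g).Integrable φ) :
    (T.withDensityᵥ g).integral φ (innerSL ℝ) = ∫ x, inner ℝ (φ x) (g x) ∂T := by
  have hV := Measure.variation_withDensityᵥ hg
  set θ : Euc n → Mat m n := fun x => ‖g x‖⁻¹ • g x with hθ
  have hθ1 : ∀ x, ‖θ x‖ ≤ 1 := fun x => by
    simp only [hθ, norm_smul, norm_inv, norm_norm]
    exact inv_mul_le_one
  have hfin := integrable_withDensity_variation hg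
  have hθm : AEStronglyMeasurable θ (T.withDensityᵥ g).variation := by
    rw [hV]
    exact (hg.aestronglyMeasurable.norm.inv₀.smul hg.aestronglyMeasurable).mono_ac
      (withDensity_absolutelyContinuous _ _)
  have key : ∀ f : Euc n → Mat m n,
      ∫ x, inner ℝ (f x) (θ x) ∂(T.withDensityᵥ g).variation = ∫ x, inner ℝ (f x) (g x) ∂T := by
    intro f
    rw [hV, integral_withDensity_eq_integral_toReal_smul₀ hg.aestronglyMeasurable.enorm
      (ae_of_all _ fun x => by simp)]
    refine integral_congr_ae (ae_of_all _ fun x => ?_)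
    simp only [hθ, toReal_enorm, inner_smul_right, smul_eq_mul]
    rcases eq_or_ne (g x) 0 with h | h
    · simp [h]
    · rw [mul_inv_cancel_left₀ (by simpa using h)]
  rw [← key]
  have hii : ∀ {f : Euc n → Mat m n}, Integrable f (T.withDensityᵥ g).variation →
      Integrable (fun x => inner ℝ (f x) (θ x)) (T.withDensityᵥ g).variation := by
    intro f hf
    refine hf.norm.mono' (hf.aestronglyMeasurable.inner hθm) (ae_of_all _ fun x => ?_)
    refine (norm_inner_le_norm _ _).trans ?_
    simpa using mul_le_mul_of_nonneg_left (hθ1 x) (norm_nonneg (f x))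
  refine Integrable.induction (μ := (T.withDensityᵥ g).variation)
    (fun f => (T.withDensityᵥ g).integral f (innerSL ℝ) =
      ∫ x, inner ℝ (f x) (θ x) ∂(T.withDensityᵥ g).variation) ?_ ?_ ?_ ?_ hφ
  · intro c s hs _
    rw [VectorMeasure.integral_indicator_const _ hs, key, withDensityᵥ_apply hg hs, innerSL_apply_apply,
      ← integral_inner hg.integrableOn, ← integral_indicator hs]
    refine integral_congr_ae (ae_of_all _ fun x => ?_)
    by_cases hx : x ∈ s <;> simp [hx]
  · intro f k _ hf hk h1 h2
    rw [VectorMeasure.integral_add hf hk, h1, h2, ← integral_add (hii hf) (hii hk)]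
    simp [inner_add_left]
  · refine isClosed_eq VectorMeasure.continuous_integral ?_
    refine LipschitzWith.continuous (K := 1) (LipschitzWith.of_dist_le_mul fun f k => ?_)
    rw [dist_eq_norm, dist_eq_norm, L1.norm_eq_integral_norm, NNReal.coe_one, one_mul,
      ← integral_sub (hii (L1.integrable_coeFn f)) (hii (L1.integrable_coeFn k))]
    refine norm_integral_le_of_norm_le (L1.integrable_coeFn (f - k)).norm ?_
    filter_upwards [Lp.coeFn_sub f k] with x hx
    rw [hx, ← inner_sub_left]
    refine (norm_inner_le_norm _ _).trans ?_
    simpa using mul_le_mul_of_nonneg_left (hθ1 x) (norm_nonneg (f x - k x))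
  · intro f k hfk _ h
    rw [← VectorMeasure.integral_congr_ae hfk, h]
    refine integral_congr_ae ?_
    filter_upwards [hfk] with x hx
    rw [hx]

lemma eq_zero_of_integral_inner_eq_zero {T : Measure (Euc n)} {g : Euc n → Mat m n}
    (hg : Integrable g T)
    (h : ∀ φ : Euc n → Mat m n, IsTestFunction Set.univ φ → ∫ x, inner ℝ (φ x) (g x) ∂T = 0) :
    ∀ᵐ x ∂T, g x = 0 := by
  refine ae_eq_zero_of_integral_contDiff_smul_eq_zero hg.locallyIntegrable fun f hf hfs => ?_
  refine ext_inner_left ℝ fun v => ?_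
  obtain ⟨C, hC⟩ := hfs.exists_bound_of_continuous hf.continuous
  have hi : Integrable (fun x => f x • g x) T :=
    hg.bdd_smul C hf.continuous.aestronglyMeasurable (ae_of_all _ hC)
  rw [← integral_inner hi, inner_zero_right,
    ← h (fun x => f x • v) ⟨hf.smul contDiff_const, hfs.smul_right, Set.subset_univ _⟩]
  refine integral_congr_ae (ae_of_all _ fun x => ?_)
  simp [inner_smul_left, inner_smul_right]

/-- The difference has a density with respect to a finite measure, and test fields detect that this
density vanishes. Consequently the choice made in `fracVariation` is immaterial. -/
lemma vectorMeasure_ext {μ ν : VectorMeasure (Euc n) (Mat m n)}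
    (h : ∀ φ : Euc n → Mat m n, IsTestFunction Set.univ φ →
      μ.integral φ (innerSL ℝ) = ν.integral φ (innerSL ℝ)) : μ = ν := by
  obtain ⟨T, g, _, hg, hT⟩ := exists_eq_withDensity (μ - ν)
  have h0 : g =ᵐ[T] 0 := by
    refine eq_zero_of_integral_inner_eq_zero hg fun φ hφ => ?_
    rw [← integral_withDensity hg (hφ.integrable_variation _), ← hT,
      VectorMeasure.integral_sub_vectorMeasure (hφ.integrable_variation _)
        (hφ.integrable_variation _), h φ hφ, sub_self]
  rw [← sub_eq_zero, hT, WithDensityᵥEq.congr_ae h0, withDensityᵥ_zero]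

lemma entry_withDensity {T : Measure (Euc n)} {g : Euc n → Mat m n} (hg : Integrable g T)
    (p : Fin m × Fin n) : entry (T.withDensityᵥ g) p = T.withDensityᵥ fun x => g x p := by
  have hgp : Integrable (fun x => g x p) T :=
    (EuclideanSpace.proj (𝕜 := ℝ) p : Mat m n →L[ℝ] ℝ).integrable_comp hg
  ext s hs
  rw [entry_apply, withDensityᵥ_apply hg hs, withDensityᵥ_apply hgp hs]
  exact ((EuclideanSpace.proj (𝕜 := ℝ) p : Mat m n →L[ℝ] ℝ).integral_comp_comm
    hg.integrableOn (μ := T.restrict s)).symm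

lemma entry_add (μ ν : VectorMeasure (Euc n) (Mat m n)) (p : Fin m × Fin n) :
    entry (μ + ν) p = entry μ p + entry ν p := by
  ext s hs
  simp [entry_apply]

/-- Uniqueness of the Lebesgue decomposition, applied to each entry; the null set of τ ⟂ volume
serves all entries. -/
lemma acDensity_ae_eq {a h : Euc n → Mat m n} {τ : Measure (Euc n)} (ha : Integrable a)
    (hh : Integrable h τ) (hτ : τ ⟂ₘ volume) :
    acDensity ((volume : Measure (Euc n)).withDensityᵥ a + τ.withDensityᵥ h) =ᵐ[volume] a := by
  have hp : ∀ p, ∀ᵐ x ∂(volume : Measure (Euc n)), a x p =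
      (entry ((volume : Measure (Euc n)).withDensityᵥ a + τ.withDensityᵥ h) p).rnDeriv volume x := by
    intro p
    have hap : Integrable (fun x => a x p) :=
      (EuclideanSpace.proj (𝕜 := ℝ) p : Mat m n →L[ℝ] ℝ).integrable_comp ha
    have hhp : Integrable (fun x => h x p) τ :=
      (EuclideanSpace.proj (𝕜 := ℝ) p : Mat m n →L[ℝ] ℝ).integrable_comp hh
    refine SignedMeasure.eq_rnDeriv (τ.withDensityᵥ fun x => h x p) _ hap ?_ ?_
    · refine VectorMeasure.MutuallySingular.mk hτ.nullSet hτ.measurableSet_nullSet ?_ ?_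
      · intro t ht htm
        rw [withDensityᵥ_apply hhp htm]
        exact setIntegral_measure_zero _ (measure_mono_null ht hτ.measure_nullSet)
      · intro t ht htm
        rw [Measure.toENNRealVectorMeasure_apply_measurable htm]
        exact measure_mono_null ht hτ.measure_compl_nullSet
    · rw [entry_add, entry_withDensity ha, entry_withDensity hh, add_comm]
  filter_upwards [ae_all_iff.2 hp] with x hx
  ext p
  exact (hx p).symm

lemma singPart_eq {a h : Euc n → Mat m n} {τ : Measure (Euc n)} (ha : Integrable a)
    (hh : Integrable h τ) (hτ : τ ⟂ₘ volume) :
    singPart ((volume : Measure (Euc n)).withDensityᵥ a + τ.withDensityᵥ h) = τ.withDensityᵥ h := by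
  rw [singPart, WithDensityᵥEq.congr_ae (acDensity_ae_eq ha hh hτ), add_sub_cancel_left]

lemma areaFunctional_eq {a h : Euc n → Mat m n} {τ : Measure (Euc n)} (ha : Integrable a)
    (hh : Integrable h τ) (hτ : τ ⟂ₘ volume) {U : Set (Euc n)} (hU : MeasurableSet U) :
    areaFunctional ((volume : Measure (Euc n)).withDensityᵥ a + τ.withDensityᵥ h) U =
      (∫⁻ x in U, ENNReal.ofReal (Real.sqrt (1 + ‖a x‖ ^ 2))) + ∫⁻ x in U, ‖h x‖ₑ ∂τ := by
  rw [areaFunctional, singPart_eq ha hh hτ, Measure.variation_withDensityᵥ hh,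
    withDensity_apply _ hU]
  congr 1
  refine lintegral_congr_ae (ae_restrict_of_ae ?_)
  filter_upwards [acDensity_ae_eq ha hh hτ] with x hx
  rw [hx]

variable {α : ℝ} {u : Euc n → Euc m} {a h : Euc n → Mat m n} {τ : Measure (Euc n)}

lemma HasVariation.isFracVariation (H : HasVariation α u a τ h) :
    IsFracVariation α u ((volume : Measure (Euc n)).withDensityᵥ a + τ.withDensityᵥ h) := by
  intro φ hφ
  rw [H.integral_eq φ hφ, VectorMeasure.integral_add_vectorMeasure (hφ.integrable_variation _)
    (hφ.integrable_variation _), integral_withDensity H.2 (hφ.integrable_variation _),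
    integral_withDensity H.3 (hφ.integrable_variation _)]

/-- This bridge converts the explicit data of `HasVariation` into statements about the chosen
measure, and with them about `fracGrad` and `areaFunctional`. -/
lemma HasVariation.fracVariation_eq (H : HasVariation α u a τ h) :
    fracVariation α u = (volume : Measure (Euc n)).withDensityᵥ a + τ.withDensityᵥ h := by
  have hex : ∃ μ : VectorMeasure (Euc n) (Mat m n), IsFracVariation α u μ :=
    ⟨_, H.isFracVariation⟩
  rw [fracVariation, dif_pos hex]
  refine vectorMeasure_ext fun φ hφ => ?_
  have h1 := hex.choose_spec φ hφ
  rw [H.isFracVariation φ hφ] at h1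
  exact (neg_injective h1).symm

lemma HasVariation.fracGrad_ae_eq (H : HasVariation α u a τ h) (hτ : τ ⟂ₘ volume) :
    fracGrad α u =ᵐ[volume] a := by
  rw [fracGrad, H.fracVariation_eq]
  exact acDensity_ae_eq H.2 H.3 hτ

lemma HasVariation.memBV (H : HasVariation α u a τ h) : MemBV α u := by
  refine ⟨H.1, (∫ x, ‖a x‖) + ∫ x, ‖h x‖ ∂τ, ?_⟩
  rintro _ ⟨φ, hφ, hφ1, rfl⟩
  have key : ∀ {ν : Measure (Euc n)} {f : Euc n → Mat m n}, Integrable f ν →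
      -(∫ x, inner ℝ (φ x) (f x) ∂ν) ≤ ∫ x, ‖f x‖ ∂ν := by
    intro ν f hf
    refine (neg_le_abs _).trans ?_
    rw [← Real.norm_eq_abs]
    refine norm_integral_le_of_norm_le hf.norm (ae_of_all _ fun x => ?_)
    refine (norm_inner_le_norm _ _).trans ?_
    simpa using mul_le_mul_of_nonneg_right (hφ1 x) (norm_nonneg (f x))
  rw [H.integral_eq φ hφ, neg_add]
  exact add_le_add (key H.2) (key H.3)

end matrix

end FractionalBV

/-! ### Riesz representation of bounded functionals by differences of finite measures -/

namespace FractionalBV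

open scoped CompactlySupported BoundedContinuousFunction

section positivePart

variable {X : Type*} [TopologicalSpace X]

/-- The positive part of a bounded functional on bounded continuous functions, evaluated at a
nonnegative function. -/
noncomputable def posPart (L : (X →ᵇ ℝ) →L[ℝ] ℝ) (F : X →ᵇ ℝ) : ℝ := sSup (L '' Set.Icc 0 F)

lemma norm_le_of_mem_Icc {F g : X →ᵇ ℝ} (hg : g ∈ Set.Icc 0 F) : ‖g‖ ≤ ‖F‖ := by
  refine (BoundedContinuousFunction.norm_le (norm_nonneg _)).2 fun x => ?_
  have h0 : 0 ≤ g x := hg.1 x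
  rw [Real.norm_of_nonneg h0]
  exact (hg.2 x).trans ((le_abs_self _).trans (F.norm_coe_le_norm x))

lemma le_norm_of_mem_Icc (L : (X →ᵇ ℝ) →L[ℝ] ℝ) {F g : X →ᵇ ℝ} (hg : g ∈ Set.Icc 0 F) :
    L g ≤ ‖L‖ * ‖F‖ := by
  refine (le_abs_self _).trans ((L.le_opNorm g).trans ?_)
  gcongr
  exact norm_le_of_mem_Icc hg

lemma bddAbove_image_Icc (L : (X →ᵇ ℝ) →L[ℝ] ℝ) (F : X →ᵇ ℝ) :
    BddAbove (L '' Set.Icc 0 F) := by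
  refine ⟨‖L‖ * ‖F‖, ?_⟩
  rintro _ ⟨g, hg, rfl⟩
  exact le_norm_of_mem_Icc L hg

lemma image_Icc_nonempty (L : (X →ᵇ ℝ) →L[ℝ] ℝ) {F : X →ᵇ ℝ} (hF : 0 ≤ F) :
    (L '' Set.Icc 0 F).Nonempty := ⟨L 0, 0, ⟨le_rfl, hF⟩, rfl⟩

lemma posPart_nonneg (L : (X →ᵇ ℝ) →L[ℝ] ℝ) {F : X →ᵇ ℝ} (hF : 0 ≤ F) : 0 ≤ posPart L F :=
  le_csSup (bddAbove_image_Icc L F) ⟨0, ⟨le_rfl, hF⟩, map_zero L⟩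

lemma posPart_le (L : (X →ᵇ ℝ) →L[ℝ] ℝ) {F : X →ᵇ ℝ} (hF : 0 ≤ F) :
    posPart L F ≤ ‖L‖ * ‖F‖ := by
  refine csSup_le (image_Icc_nonempty L hF) ?_
  rintro _ ⟨g, hg, rfl⟩
  exact le_norm_of_mem_Icc L hg

/-- Riesz decomposition: any g with 0 ≤ g ≤ F + G splits as g ⊓ F plus a remainder lying between 0
and G. -/
lemma posPart_add (L : (X →ᵇ ℝ) →L[ℝ] ℝ) {F G : X →ᵇ ℝ} (hF : 0 ≤ F) (hG : 0 ≤ G) :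
    posPart L (F + G) = posPart L F + posPart L G := by
  apply le_antisymm
  · refine csSup_le (image_Icc_nonempty L (add_nonneg hF hG)) ?_
    rintro _ ⟨g, hg, rfl⟩
    have h1 : g ⊓ F ∈ Set.Icc 0 F := ⟨le_inf hg.1 hF, inf_le_right⟩
    have h2 : g - g ⊓ F ∈ Set.Icc 0 G := by
      refine ⟨sub_nonneg.2 inf_le_left, fun x => ?_⟩
      have hx : g x ≤ F x + G x := hg.2 x
      have hGx : 0 ≤ G x := hG x
      change g x - min (g x) (F x) ≤ G x
      rcases le_total (g x) (F x) with h | h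
      · simpa [h] using hGx
      · simp only [min_eq_right h]
        linarith
    have h3 : L g = L (g ⊓ F) + L (g - g ⊓ F) := by rw [← map_add, add_sub_cancel]
    rw [h3]
    exact add_le_add (le_csSup (bddAbove_image_Icc L F) ⟨_, h1, rfl⟩)
      (le_csSup (bddAbove_image_Icc L G) ⟨_, h2, rfl⟩)
  · rw [← le_sub_iff_add_le]
    refine csSup_le (image_Icc_nonempty L hF) ?_
    rintro _ ⟨f, hf, rfl⟩
    rw [le_sub_comm]
    refine csSup_le (image_Icc_nonempty L hG) ?_
    rintro _ ⟨g, hg, rfl⟩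
    rw [le_sub_iff_add_le, add_comm, ← map_add]
    exact le_csSup (bddAbove_image_Icc L _) ⟨_, ⟨add_nonneg hf.1 hg.1, add_le_add hf.2 hg.2⟩, rfl⟩

/-- One inequality, used for c and for its inverse, gives both directions; c = 0 is separate. -/
lemma posPart_smul (L : (X →ᵇ ℝ) →L[ℝ] ℝ) {F : X →ᵇ ℝ} (hF : 0 ≤ F) {c : ℝ} (hc : 0 ≤ c) :
    posPart L (c • F) = c * posPart L F := by
  have key : ∀ {F : X →ᵇ ℝ}, 0 ≤ F → ∀ {c : ℝ}, 0 ≤ c → c * posPart L F ≤ posPart L (c • F) := by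
    intro F hF c hc
    rcases hc.eq_or_lt with rfl | hc0
    · simpa using posPart_nonneg L le_rfl
    rw [← le_div_iff₀' hc0]
    refine csSup_le (image_Icc_nonempty L hF) ?_
    rintro _ ⟨g, hg, rfl⟩
    rw [le_div_iff₀' hc0, ← smul_eq_mul, ← map_smul]
    refine le_csSup (bddAbove_image_Icc L _) ⟨_, ⟨fun x => ?_, fun x => ?_⟩, rfl⟩
    · exact mul_nonneg hc (hg.1 x)
    · exact mul_le_mul_of_nonneg_left (hg.2 x) hc
  refine le_antisymm ?_ (key hF hc)
  rcases hc.eq_or_lt with rfl | hc0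
  · have := posPart_le L (le_refl (0 : X →ᵇ ℝ))
    simpa using this
  have hcF : 0 ≤ c • F := fun x => mul_nonneg hc (hF x)
  have := key hcF (inv_nonneg.2 hc)
  rwa [smul_smul, inv_mul_cancel₀ hc0.ne', one_smul, inv_mul_le_iff₀ hc0] at this

/-- The reflection g ↦ F - g of the order interval [0, F] turns competitors for L into competitors
for -L. -/
lemma posPart_sub_posPart_neg (L : (X →ᵇ ℝ) →L[ℝ] ℝ) {F : X →ᵇ ℝ} (hF : 0 ≤ F) :
    posPart L F - posPart (-L) F = L F := by
  have key : ∀ L L' : (X →ᵇ ℝ) →L[ℝ] ℝ, (∀ g, L' g = -L g) →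
      posPart L F ≤ L F + posPart L' F := by
    intro L L' h
    refine csSup_le (image_Icc_nonempty L hF) ?_
    rintro _ ⟨g, hg, rfl⟩
    have := le_csSup (bddAbove_image_Icc L' F)
      ⟨F - g, ⟨sub_nonneg.2 hg.2, sub_le_self _ hg.1⟩, rfl⟩
    rw [h, map_sub] at this
    change _ ≤ posPart L' F at this
    linarith
  have h1 := key L (-L) fun g => rfl
  have h2 := key (-L) L fun g => (neg_neg _).symm
  have h3 : (-L) F = -L F := rfl
  linarith

/-- A compactly supported continuous function as a bounded continuous function. -/
noncomputable def toBounded (f : C_c(X, ℝ)) : X →ᵇ ℝ :=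
  BoundedContinuousFunction.ofNormedAddCommGroup f f.continuous _
    (f.hasCompactSupport.exists_bound_of_continuous f.continuous).choose_spec

@[simp] lemma toBounded_apply (f : C_c(X, ℝ)) (x : X) : toBounded f x = f x := rfl

lemma toBounded_toReal_nonneg (f : C_c(X, ℝ≥0)) : 0 ≤ toBounded f.toReal := fun x => by
  simp

/-- The positive part of a bounded functional, as a positive functional on `C_c(X, ℝ≥0)`. -/
noncomputable def posPartLinear (L : (X →ᵇ ℝ) →L[ℝ] ℝ) : C_c(X, ℝ≥0) →ₗ[ℝ≥0] ℝ≥0 where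
  toFun f := (posPart L (toBounded f.toReal)).toNNReal
  map_add' f g := by
    rw [← Real.toNNReal_add (posPart_nonneg L (toBounded_toReal_nonneg f))
      (posPart_nonneg L (toBounded_toReal_nonneg g)),
      ← posPart_add L (toBounded_toReal_nonneg f) (toBounded_toReal_nonneg g)]
    congr 2
    ext x
    simp
  map_smul' c f := by
    have hc : toBounded (c • f).toReal = (c : ℝ) • toBounded f.toReal := by
      ext x
      simp
      rfl
    rw [RingHom.id_apply, smul_eq_mul, hc, posPart_smul L (toBounded_toReal_nonneg f) c.coe_nonneg,
      Real.toNNReal_mul c.coe_nonneg, Real.toNNReal_coe]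

lemma coe_posPartLinear (L : (X →ᵇ ℝ) →L[ℝ] ℝ) (f : C_c(X, ℝ≥0)) :
    (posPartLinear L f : ℝ) = posPart L (toBounded f.toReal) :=
  Real.coe_toNNReal _ (posPart_nonneg L (toBounded_toReal_nonneg f))

variable [T2Space X] [LocallyCompactSpace X] [MeasurableSpace X] [BorelSpace X]

/-- A cutoff with values in [0, 1] equal to one on a compact K bounds the mass of K by ‖L‖, and
inner regularity carries this over to the whole space. -/
lemma isFiniteMeasure_rieszMeasure_posPartLinear (L : (X →ᵇ ℝ) →L[ℝ] ℝ) :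
    IsFiniteMeasure (NNRealRMK.rieszMeasure (posPartLinear L)) := by
  refine ⟨?_⟩
  rw [isOpen_univ.measure_eq_iSup_isCompact]
  refine lt_of_le_of_lt (b := ENNReal.ofReal ‖L‖) ?_ ENNReal.ofReal_lt_top
  refine iSup₂_le fun K _ => iSup_le fun hK => ?_
  obtain ⟨f, hf1, -, hfs, hf01⟩ := exists_continuous_one_zero_of_isCompact hK isClosed_empty
    (Set.disjoint_empty K)
  set F : C_c(X, ℝ≥0) := (⟨f, hfs⟩ : C_c(X, ℝ)).nnrealPart with hF
  have hFv : ∀ x, F x = Real.toNNReal (f x) := fun x => rfl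
  calc NNRealRMK.rieszMeasure (posPartLinear L) K = ∫⁻ x in K, 1 ∂(NNRealRMK.rieszMeasure (posPartLinear L)) := by simp
    _ ≤ ∫⁻ x in K, F x ∂(NNRealRMK.rieszMeasure (posPartLinear L)) := by
        refine setLIntegral_mono' hK.measurableSet fun x hx => ?_
        rw [hFv, hf1 hx]
        simp
    _ ≤ ∫⁻ x, F x ∂(NNRealRMK.rieszMeasure (posPartLinear L)) := setLIntegral_le_lintegral _ _
    _ = posPartLinear L F := NNRealRMK.lintegral_rieszMeasure _ _
    _ ≤ ENNReal.ofReal ‖L‖ := by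
        rw [← ENNReal.ofReal_coe_nnreal]
        refine ENNReal.ofReal_le_ofReal ?_
        rw [coe_posPartLinear]
        refine (posPart_le L (toBounded_toReal_nonneg F)).trans ?_
        refine mul_le_of_le_one_right (norm_nonneg L) ?_
        refine (BoundedContinuousFunction.norm_le zero_le_one).2 fun x => ?_
        have h0 := (hf01 x).1
        have h1 := (hf01 x).2
        simp only [toBounded_apply, CompactlySupportedContinuousMap.toReal_apply, hFv,
          Real.coe_toNNReal _ h0]
        rwa [Real.norm_of_nonneg h0]

lemma exists_integral_sub_integral (L : (X →ᵇ ℝ) →L[ℝ] ℝ) :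
    ∃ μ ν : Measure X, IsFiniteMeasure μ ∧ IsFiniteMeasure ν ∧
      ∀ f : C_c(X, ℝ), L (toBounded f) = ∫ x, f x ∂μ - ∫ x, f x ∂ν := by
  have h1 := isFiniteMeasure_rieszMeasure_posPartLinear L
  have h2 := isFiniteMeasure_rieszMeasure_posPartLinear (-L)
  refine ⟨_, _, h1, h2, fun f => ?_⟩
  have key : ∀ g : C_c(X, ℝ≥0), L (toBounded g.toReal) =
      ∫ x, g.toReal x ∂(NNRealRMK.rieszMeasure (posPartLinear L)) -
        ∫ x, g.toReal x ∂(NNRealRMK.rieszMeasure (posPartLinear (-L))) := by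
    intro g
    simp only [CompactlySupportedContinuousMap.toReal_apply]
    rw [NNRealRMK.integral_rieszMeasure, NNRealRMK.integral_rieszMeasure, coe_posPartLinear,
      coe_posPartLinear]
    exact (posPart_sub_posPart_neg L (toBounded_toReal_nonneg g)).symm
  have hf := CompactlySupportedContinuousMap.nnrealPart_sub_nnrealPart_neg f
  have hsub : toBounded f = toBounded f.nnrealPart.toReal - toBounded (-f).nnrealPart.toReal := by
    nth_rewrite 1 [← hf]
    ext x
    simp
  have hint : ∀ (g : C_c(X, ℝ)) (μ : Measure X) [IsFiniteMeasure μ], Integrable g μ :=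
    fun g μ _ => g.continuous.integrable_of_hasCompactSupport g.hasCompactSupport
  have hi : ∀ (μ : Measure X) [IsFiniteMeasure μ], ∫ x, f x ∂μ =
      ∫ x, f.nnrealPart.toReal x ∂μ - ∫ x, (-f).nnrealPart.toReal x ∂μ := by
    intro μ _
    rw [← integral_sub (hint _ _) (hint _ _)]
    refine integral_congr_ae (ae_of_all _ fun x => ?_)
    simp
  rw [hsub, map_sub, key, key, hi, hi]
  ring

end positivePart

/-- A functional on test functions that is bounded for the supremum norm is given by a difference
of finite measures. -/
lemma exists_measures_of_bounded {n : ℕ} (ℓ : (Euc n → ℝ) → ℝ) (C : ℝ)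
    (hadd : ∀ f g, IsTestFunction Set.univ f → IsTestFunction Set.univ g → ℓ (f + g) = ℓ f + ℓ g)
    (hsmul : ∀ (c : ℝ) f, IsTestFunction Set.univ f → ℓ (c • f) = c * ℓ f)
    (hC : ∀ f, IsTestFunction Set.univ f → ∀ B > 0, (∀ x, |f x| ≤ B) → ℓ f ≤ C * B) :
    ∃ μ ν : Measure (Euc n), IsFiniteMeasure μ ∧ IsFiniteMeasure ν ∧
      ∀ f, IsTestFunction Set.univ f → ℓ f = ∫ x, f x ∂μ - ∫ x, f x ∂ν := by
  have hT0 : IsTestFunction (n := n) (F := ℝ) Set.univ 0 :=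
    ⟨contDiff_const, HasCompactSupport.zero, Set.subset_univ _⟩
  have hTadd : ∀ {f g : Euc n → ℝ}, IsTestFunction Set.univ f → IsTestFunction Set.univ g →
      IsTestFunction Set.univ (f + g) := fun hf hg =>
    ⟨hf.1.add hg.1, hf.2.1.add hg.2.1, Set.subset_univ _⟩
  have hTsmul : ∀ (c : ℝ) {f : Euc n → ℝ}, IsTestFunction Set.univ f →
      IsTestFunction Set.univ (c • f) := fun c f hf =>
    ⟨contDiff_const.smul hf.1, hf.2.1.smul_left (f := fun _ => c), Set.subset_univ _⟩
  let S : Subspace ℝ (Euc n →ᵇ ℝ) :=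
    { carrier := {f | IsTestFunction Set.univ f}
      add_mem' := fun hf hg => hTadd hf hg
      zero_mem' := hT0
      smul_mem' := fun c f hf => hTsmul c hf }
  let l : S →ₗ[ℝ] ℝ :=
    { toFun := fun f => ℓ f.1
      map_add' := fun f g => hadd _ _ f.2 g.2
      map_smul' := fun c f => hsmul c _ f.2 }
  have hb : ∀ f : S, l f ≤ C * ‖f‖ := by
    intro f
    rcases eq_or_ne f 0 with rfl | hf
    · simp
    · exact hC f.1 f.2 ‖f.1‖ (norm_pos_iff.2 fun h => hf (Subtype.ext h)) fun x => f.1.norm_coe_le_norm x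
  have hb' : ∀ f : S, ‖l f‖ ≤ C * ‖f‖ := by
    intro f
    rw [Real.norm_eq_abs, abs_le']
    refine ⟨hb f, ?_⟩
    have h1 := hb (-f)
    have h2 : l (-f) = -l f := map_neg l f
    have h3 : ‖-f‖ = ‖f‖ := norm_neg f.1
    rwa [h2, h3] at h1
  -- Hahn–Banach extends the functional from test functions to all bounded continuous functions,
  -- where order intervals are available for the positive part.
  obtain ⟨L, hL, -⟩ := exists_extension_norm_eq S (l.mkContinuous C hb')
  obtain ⟨μ, ν, hμ, hν, h⟩ := exists_integral_sub_integral L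
  refine ⟨μ, ν, hμ, hν, fun f hf => ?_⟩
  let F : C_c(Euc n, ℝ) := ⟨⟨f, hf.1.continuous⟩, hf.2.1⟩
  have hFS : toBounded F ∈ S := hf
  have h1 := hL ⟨toBounded F, hFS⟩
  have h2 := h F
  rw [h1] at h2
  exact h2

/-! ### The structure theorem for BV^α -/

section existence

variable {n m : ℕ} {α : ℝ} (hn : 1 ≤ n) (hα₀ : 0 < α) (hα₁ : α < 1)
include hn hα₀ hα₁

/-- The structure theorem for `BV^α`: the fractional variation is represented by a measure, here
split into its absolutely continuous and singular parts. -/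
lemma MemBV.exists_hasVariation {u : Euc n → Euc m} (hu : MemBV α u) :
    ∃ (a : Euc n → Mat m n) (τ : Measure (Euc n)) (h : Euc n → Mat m n), IsFiniteMeasure τ ∧
      τ ⟂ₘ volume ∧ HasVariation α u a τ h := by
  obtain ⟨hui, M, hM⟩ := hu
  set L : (Euc n → Mat m n) → ℝ := fun φ => ∫ x, inner ℝ (u x) (fracDiv α φ x) with hL
  have hLadd : ∀ φ ψ, IsTestFunction Set.univ φ → IsTestFunction Set.univ ψ →
      L (φ + ψ) = L φ + L ψ := by
    intro φ ψ hφ hψ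
    simp only [hL, fracDiv_add hn hα₀ hα₁ hφ hψ, inner_add_right]
    exact integral_add (integrable_inner_fracDiv hn hα₀ hα₁ hui hφ)
      (integrable_inner_fracDiv hn hα₀ hα₁ hui hψ)
  have hLsmul : ∀ (c : ℝ) φ, L (c • φ) = c * L φ := by
    intro c φ
    simp only [hL, fracDiv_smul, inner_smul_right, integral_const_mul]
  set e : Fin m × Fin n → Mat m n := fun p => EuclideanSpace.single p 1 with he
  have htest : ∀ {f : Euc n → ℝ} (p : Fin m × Fin n), IsTestFunction Set.univ f →
      IsTestFunction Set.univ fun x => f x • e p := fun p hf =>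
    ⟨hf.1.smul contDiff_const, hf.2.1.smul_right, Set.subset_univ _⟩
  have htest' : ∀ {f : Euc n → ℝ} (p : Fin m × Fin n) (c : ℝ), IsTestFunction Set.univ f →
      IsTestFunction Set.univ (c • fun x => f x • e p) := fun p c hf =>
    ⟨contDiff_const.smul (htest p hf).1, (htest p hf).2.1.smul_left (f := fun _ => c),
      Set.subset_univ _⟩
  have hrep : ∀ p, ∃ μ ν : Measure (Euc n), IsFiniteMeasure μ ∧ IsFiniteMeasure ν ∧
      ∀ f, IsTestFunction Set.univ f → -L (fun x => f x • e p) = ∫ x, f x ∂μ - ∫ x, f x ∂ν := by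
    intro p
    refine exists_measures_of_bounded (fun f => -L fun x => f x • e p) M ?_ ?_ ?_
    · intro f g hf hg
      rw [← neg_add, ← hLadd _ _ (htest p hf) (htest p hg)]
      congr 2
      ext1 x
      simp [add_smul]
    · intro c f hf
      rw [mul_neg, ← hLsmul]
      congr 2
      ext1 x
      simp [smul_smul]
    · intro f hf B hB hfB
      -- The supremum in `MemBV` is one-sided and the represented functional is -L, hence the
      -- negative normalizing factor.
      have h1 : L ((-B⁻¹) • fun x => f x • e p) ≤ M := by
        refine hM ⟨_, htest' p (-B⁻¹) hf, fun x => ?_, rfl⟩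
        change ‖(-B⁻¹) • (f x • e p)‖ ≤ 1
        simp only [norm_smul, he, norm_neg, norm_inv, Real.norm_of_nonneg hB.le,
          PiLp.norm_single, norm_one, mul_one]
        rw [inv_mul_le_iff₀ hB, mul_one]
        exact hfB x
      rw [hLsmul] at h1
      rw [mul_comm, ← inv_mul_le_iff₀ hB]
      linarith
  choose μ ν hμ hν hμν using hrep
  -- T dominates all the entry measures, so a single matrix density h with respect to T represents
  -- L.
  set T : Measure (Euc n) := ∑ p, (μ p + ν p) with hT
  have hTfin : IsFiniteMeasure T := by
    refine ⟨?_⟩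
    rw [hT, Measure.finsetSum_apply]
    exact ENNReal.sum_lt_top.2 fun p _ => measure_lt_top _ _
  have hle : ∀ p, μ p + ν p ≤ T := fun p =>
    Finset.single_le_sum (f := fun p => μ p + ν p) (fun _ _ => Measure.zero_le _)
      (Finset.mem_univ p)
  have hμT : ∀ p, μ p ≪ T := fun p =>
    (le_trans (Measure.le_add_right le_rfl) (hle p)).absolutelyContinuous
  have hνT : ∀ p, ν p ≪ T := fun p =>
    (le_trans (Measure.le_add_left le_rfl) (hle p)).absolutelyContinuous
  have hμL : ∀ p, (μ p).HaveLebesgueDecomposition T := fun p =>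
    have := hμ p
    Measure.haveLebesgueDecomposition_of_sigmaFinite _ _
  have hνL : ∀ p, (ν p).HaveLebesgueDecomposition T := fun p =>
    have := hν p
    Measure.haveLebesgueDecomposition_of_sigmaFinite _ _
  set h : Euc n → Mat m n := fun x => WithLp.toLp 2 fun p =>
    ((μ p).rnDeriv T x).toReal - ((ν p).rnDeriv T x).toReal with hh
  have hhi : Integrable h T := Integrable.of_eval_piLp fun p =>
    Measure.integrable_toReal_rnDeriv.sub Measure.integrable_toReal_rnDeriv
  have hTrep : ∀ φ : Euc n → Mat m n, IsTestFunction Set.univ φ →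
      L φ = -∫ x, inner ℝ (φ x) (h x) ∂T := by
    intro φ hφ
    have hφp : ∀ p, IsTestFunction Set.univ fun x => φ x p := fun p =>
      ⟨(EuclideanSpace.proj (𝕜 := ℝ) p : Mat m n →L[ℝ] ℝ).contDiff.comp hφ.1,
        hφ.2.1.comp_left (g := fun v : Mat m n => v p) rfl, Set.subset_univ _⟩
    have hLsum : ∀ s : Finset (Fin m × Fin n),
        IsTestFunction Set.univ (∑ p ∈ s, fun x => φ x p • e p) ∧
        L (∑ p ∈ s, fun x => φ x p • e p) = ∑ p ∈ s, L (fun x => φ x p • e p) := by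
      intro s
      classical
      induction s using Finset.induction_on with
      | empty =>
        refine ⟨⟨contDiff_const, HasCompactSupport.zero, Set.subset_univ _⟩, ?_⟩
        have := hLsmul 0 0
        simpa using this
      | insert p s hp ih =>
        rw [Finset.sum_insert hp, Finset.sum_insert hp]
        have ht := htest p (hφp p)
        refine ⟨⟨ht.1.add ih.1.1, ht.2.1.add ih.1.2.1, Set.subset_univ _⟩, ?_⟩
        rw [hLadd _ _ ht ih.1, ih.2]
    have hdec : φ = ∑ p, fun x => φ x p • e p := by
      ext x q
      simp [he, Finset.sum_apply, Pi.single_apply]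
    have hint : ∀ (p : Fin m × Fin n) (σ : Measure (Euc n)) [IsFiniteMeasure σ],
        Integrable (fun x => φ x p) σ := fun p σ _ =>
      (hφp p).1.continuous.integrable_of_hasCompactSupport (hφp p).2.1
    rw [hdec, (hLsum _).2, ← hdec]
    have hin : ∀ x, inner ℝ (φ x) (h x) = ∑ p, (((μ p).rnDeriv T x).toReal • φ x p -
        ((ν p).rnDeriv T x).toReal • φ x p) := by
      intro x
      simp only [PiLp.inner_apply, hh, RCLike.inner_apply, conj_trivial, sub_mul, smul_eq_mul]
    simp_rw [hin]
    have i1 : ∀ p, Integrable (fun x => ((μ p).rnDeriv T x).toReal • φ x p) T := fun p =>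
      have := hμ p
      have := hμL p
      (integrable_rnDeriv_smul_iff (hμT p)).2 (hint p _)
    have i2 : ∀ p, Integrable (fun x => ((ν p).rnDeriv T x).toReal • φ x p) T := fun p =>
      have := hν p
      have := hνL p
      (integrable_rnDeriv_smul_iff (hνT p)).2 (hint p _)
    have i3 : ∀ p, Integrable (fun x => ((μ p).rnDeriv T x).toReal • φ x p -
        ((ν p).rnDeriv T x).toReal • φ x p) T := fun p => (i1 p).sub (i2 p)
    rw [integral_finsetSum _ fun p _ => i3 p, ← Finset.sum_neg_distrib]
    refine Finset.sum_congr rfl fun p _ => ?_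
    have := hμ p
    have := hμL p
    have := hν p
    have := hνL p
    rw [integral_sub (i1 p) (i2 p), integral_rnDeriv_smul (hμT p), integral_rnDeriv_smul (hνT p),
      ← hμν p _ (hφp p), neg_neg]
  -- Splitting the scalar measure T splits h T: h stays the density of the singular part, and the
  -- absolutely continuous density is h times dT/dx.
  have hdec := T.haveLebesgueDecomposition_add (volume : Measure (Euc n))
  have hhw : Integrable h ((volume : Measure (Euc n)).withDensity (T.rnDeriv volume)) :=
    hhi.mono_measure (by
      conv_rhs => rw [hdec]
      exact Measure.le_add_left le_rfl)
  have hhs : Integrable h (T.singularPart volume) :=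
    hhi.mono_measure (Measure.singularPart_le _ _)
  have hrn : AEMeasurable (T.rnDeriv volume) (volume : Measure (Euc n)) :=
    (Measure.measurable_rnDeriv _ _).aemeasurable
  have hrnlt : ∀ᵐ x ∂(volume : Measure (Euc n)), T.rnDeriv volume x < ⊤ := T.rnDeriv_lt_top _
  refine ⟨fun x => (T.rnDeriv volume x).toReal • h x, T.singularPart volume, h, inferInstance,
    T.mutuallySingular_singularPart _, hui, ?_, hhs, fun φ hφ => ?_⟩
  · exact (integrable_withDensity_iff_integrable_smul₀' hrn hrnlt).1 hhw
  · change L φ = _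
    rw [hTrep φ hφ]
    congr 1
    have e1 : ∫ x, inner ℝ (φ x) (h x) ∂T =
        ∫ x, inner ℝ (φ x) (h x) ∂(T.singularPart volume) +
          ∫ x, inner ℝ (φ x) (h x) ∂((volume : Measure (Euc n)).withDensity (T.rnDeriv volume)) := by
      rw [← integral_add_measure (hφ.integrable_inner hhs) (hφ.integrable_inner hhw), ← hdec]
    rw [e1, add_comm, integral_withDensity_eq_integral_toReal_smul₀ hrn hrnlt]
    congr 1
    refine integral_congr_ae (ae_of_all _ fun x => ?_)
    simp only [inner_smul_right, smul_eq_mul]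

end existence

end FractionalBV

/-! ### Pushing a Lipschitz domain into itself -/

namespace FractionalBV

section geometry

variable {n : ℕ} {Ω : Set (Euc n)}

/-- Near every point of its closure, a Lipschitz domain can be pushed into itself by small
translations in a fixed direction. -/
lemma IsBoundedLipschitzDomain.exists_shift (hΩ : IsBoundedLipschitzDomain Ω) {x : Euc n}
    (hx : x ∈ closure Ω) : ∃ r > 0, ∃ (e : Euc n), ∃ s₀ > 0, ∀ s : ℝ, 0 < s → s < s₀ →
      ∀ y ∈ closure Ω, y ∈ Metric.closedBall x r → y + s • e ∈ Ω := by
  by_cases hxΩ : x ∈ Ω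
  · obtain ⟨ε, hε, hball⟩ := Metric.isOpen_iff.1 hΩ.1 x hxΩ
    -- Interior points need no translation, so the direction is 0.
    refine ⟨ε / 2, by positivity, 0, 1, one_pos, fun s _ _ y _ hy => hball ?_⟩
    rw [smul_zero, add_zero]
    exact Metric.closedBall_subset_ball (by linarith) hy
  · have hfr : x ∈ frontier Ω := ⟨hx, by rwa [hΩ.1.interior_eq]⟩
    obtain ⟨r, hr, e, he, K, γ, hγ, hgraph⟩ := hΩ.2.2 x hfr
    -- A point within r / 4 of x, moved by less than r / 4, stays in the ball where the graph
    -- description holds.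
    refine ⟨r / 4, by positivity, e, r / 4, by positivity, fun s hs0 hs y hy hyr => ?_⟩
    rw [Metric.mem_closedBall] at hyr
    -- On the closure the graph inequality survives in non-strict form; moving by s along e leaves
    -- the orthogonal part unchanged and adds s to the height, which makes it strict.
    have hle : γ (y - inner ℝ e y • e) ≤ inner ℝ e y := by
      have hclosed : IsClosed {z : Euc n | γ (z - inner ℝ e z • e) ≤ inner ℝ e z} := by
        have := hγ.continuous
        exact isClosed_le (by fun_prop) (by fun_prop)
      have hsub : Metric.ball x r ∩ Ω ⊆ {z : Euc n | γ (z - inner ℝ e z • e) ≤ inner ℝ e z} :=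
        fun z hz => ((hgraph z hz.1).1 hz.2).le
      have hmem : y ∈ closure (Metric.ball x r ∩ Ω) :=
        Metric.isOpen_ball.inter_closure ⟨by rw [Metric.mem_ball]; linarith, hy⟩
      exact closure_minimal hsub hclosed hmem
    have hyball : y + s • e ∈ Metric.ball x r := by
      rw [Metric.mem_ball]
      have h1 : dist (y + s • e) y = s := by
        rw [dist_eq_norm, add_sub_cancel_left, norm_smul, he, mul_one, Real.norm_of_nonneg hs0.le]
      linarith [dist_triangle (y + s • e) y x]
    have hee : inner ℝ e (y + s • e) = inner ℝ e y + s := by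
      rw [inner_add_right, inner_smul_right, real_inner_self_eq_norm_sq, he]
      ring
    rw [hgraph _ hyball, hee]
    have hproj : y + s • e - (inner ℝ e y + s) • e = y - inner ℝ e y • e := by
      rw [add_smul]
      abel
    rw [hproj]
    linarith

/-- A bump centred at s e rather than at the origin: smearing K then lands near the translate K + s
e, a compact subset of Ω, even where K touches the boundary. -/
lemma exists_mollifier_of_shift (hΩ : IsOpen Ω) {K : Set (Euc n)} (hK : IsCompact K) {e : Euc n}
    {s₀ : ℝ} (hs₀ : 0 < s₀) (hshift : ∀ s : ℝ, 0 < s → s < s₀ → ∀ y ∈ K, y + s • e ∈ Ω) {δ : ℝ}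
    (hδ : 0 < δ) : ∃ η, IsMollifier δ η ∧ ∃ C, IsCompact C ∧ C ⊆ Ω ∧
      ∀ y ∈ K, ∀ x, η (x - y) ≠ 0 → x ∈ C := by
  set s : ℝ := min (s₀ / 2) (δ / (2 * (‖e‖ + 1))) with hs
  have hs0 : 0 < s := by positivity
  have hss₀ : s < s₀ := (min_le_left _ _).trans_lt (by linarith)
  have hse : ‖s • e‖ ≤ δ / 2 := by
    rw [norm_smul, Real.norm_of_nonneg hs0.le]
    have h1 : s ≤ δ / (2 * (‖e‖ + 1)) := min_le_right _ _
    rw [le_div_iff₀ (by positivity)] at h1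
    nlinarith [norm_nonneg e]
  have hK' : IsCompact ((fun y => y + s • e) '' K) := hK.image (by fun_prop)
  obtain ⟨ε, hε, hεΩ⟩ := hK'.exists_cthickening_subset_open hΩ (by
    rintro _ ⟨y, hy, rfl⟩
    exact hshift s hs0 hss₀ y hy)
  -- The bump radius stays below the distance ε available around K + s e, and together with ‖s e‖ ≤
  -- δ / 2 keeps the support within δ of the origin.
  set ε' : ℝ := min ε (δ / 2) with hε'
  have hε'0 : 0 < ε' := by positivity
  let b : ContDiffBump (s • e) := ⟨ε' / 2, ε', by positivity, by linarith⟩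
  have hsupp : ∀ z, b.normed volume z ≠ 0 → ‖z - s • e‖ < ε' := by
    intro z hz
    have : z ∈ Function.support (b.normed volume) := hz
    rw [b.support_normed_eq, Metric.mem_ball, dist_eq_norm] at this
    exact this
  refine ⟨b.normed volume, ⟨⟨b.contDiff_normed, b.hasCompactSupport_normed, Set.subset_univ _⟩,
    b.nonneg_normed, b.integral_normed, fun z hz => ?_⟩,
    Metric.cthickening ε ((fun y => y + s • e) '' K), hK'.cthickening, hεΩ, fun y hy x hx => ?_⟩
  · have h1 := hsupp z hz
    have h2 := norm_add_le (z - s • e) (s • e)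
    rw [sub_add_cancel] at h2
    have h3 : ε' ≤ δ / 2 := min_le_right _ _
    linarith
  · refine Metric.mem_cthickening_of_dist_le x (y + s • e) ε _ ⟨y, hy, rfl⟩ ?_
    have h1 := hsupp _ hx
    have h3 : ε' ≤ ε := min_le_left _ _
    rw [dist_eq_norm, ← sub_sub]
    linarith

/-- A smooth partition of unity on the closure of a bounded Lipschitz domain such that each piece
is moved into a compact subset of the domain by suitable mollifiers of arbitrarily small support. -/
lemma IsBoundedLipschitzDomain.exists_partition (hΩ : IsBoundedLipschitzDomain Ω) :
    ∃ (ι : Type) (_ : Fintype ι) (χ : ι → Euc n → ℝ),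
      (∀ i, IsTestFunction Set.univ (χ i)) ∧ (∀ i x, 0 ≤ χ i x) ∧
      (∀ x ∈ closure Ω, ∑ i, χ i x = 1) ∧
      ∀ i, ∀ δ > 0, ∃ η, IsMollifier δ η ∧ ∃ C, IsCompact C ∧ C ⊆ Ω ∧
        ∀ y ∈ closure Ω, χ i y ≠ 0 → ∀ x, η (x - y) ≠ 0 → x ∈ C := by
  have hcomp : IsCompact (closure Ω) := hΩ.2.1.isCompact_closure
  choose! r hr e s₀ hs₀ hshift using fun x (hx : x ∈ closure Ω) => hΩ.exists_shift hx
  obtain ⟨t, htΩ, htcover⟩ := hcomp.elim_nhds_subcover (fun x => Metric.ball x (r x))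
    fun x hx => Metric.ball_mem_nhds x (hr x hx)
  obtain ⟨f, hf⟩ := SmoothPartitionOfUnity.exists_isSubordinate (modelWithCornersSelf ℝ (Euc n))
    isClosed_closure (fun i : t => Metric.ball i.1 (r i.1)) (fun i => Metric.isOpen_ball)
    (fun x hx => by simpa using htcover hx)
  have hsub : ∀ i : t, Function.support (f i) ⊆ Metric.closedBall i.1 (r i.1) := fun i =>
    (subset_tsupport _).trans ((hf i).trans Metric.ball_subset_closedBall)
  obtain ⟨k, ⟨σ⟩⟩ := Finite.exists_equiv_fin t
  refine ⟨Fin k, inferInstance, fun i x => f (σ.symm i) x, fun i => ⟨?_, ?_, Set.subset_univ _⟩,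
    fun i x => f.nonneg _ _, fun x hx => ?_, fun i δ hδ => ?_⟩
  · exact (f (σ.symm i)).contMDiff.contDiff
  · exact HasCompactSupport.of_support_subset_isCompact (isCompact_closedBall _ _) (hsub _)
  · rw [σ.symm.sum_comp (fun i => f i x), ← finsum_eq_sum_of_fintype]
    exact f.sum_eq_one hx
  · set x₀ := σ.symm i
    have hx₀ : x₀.1 ∈ closure Ω := htΩ _ x₀.2
    obtain ⟨η, hη, C, hC, hCΩ, h⟩ := exists_mollifier_of_shift hΩ.1
      (hcomp.inter_right (Metric.isClosed_closedBall (x := x₀.1) (ε := r x₀.1))) (hs₀ _ hx₀)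
      (fun s hs hs' y hy => hshift _ hx₀ s hs hs' y hy.1 hy.2) hδ
    exact ⟨η, hη, C, hC, hCΩ, fun y hy hyχ x hx => h y ⟨hy, hsub _ hyχ⟩ x hx⟩

end geometry

end FractionalBV

/-! ### Convergence of the area integral -/

namespace FractionalBV

section areaLimit

variable {n : ℕ} {F : Type*} [NormedAddCommGroup F]

lemma norm_le_sqrt_one_add (v : F) : ‖v‖ ≤ √(1 + ‖v‖ ^ 2) :=
  Real.le_sqrt_of_sq_le (by linarith)

lemma sqrt_one_add_le (v : F) : √(1 + ‖v‖ ^ 2) ≤ 1 + ‖v‖ := by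
  rw [Real.sqrt_le_left (by positivity)]
  nlinarith [norm_nonneg v]

lemma sqrt_one_add_sub_le (v w : F) : √(1 + ‖v‖ ^ 2) ≤ √(1 + ‖w‖ ^ 2) + ‖v - w‖ := by
  rw [Real.sqrt_le_left (by positivity)]
  have h1 : ‖v‖ ≤ ‖w‖ + ‖v - w‖ := by
    simpa [add_comm] using norm_add_le (v - w) w
  have h2 := norm_le_sqrt_one_add w
  have h3 : √(1 + ‖w‖ ^ 2) ^ 2 = 1 + ‖w‖ ^ 2 := Real.sq_sqrt (by positivity)
  nlinarith [norm_nonneg v, norm_nonneg w, norm_nonneg (v - w)]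

lemma integrable_sqrt_one_add {ν : Measure (Euc n)} [IsFiniteMeasure ν] {f : Euc n → F}
    (hf : Integrable f ν) : Integrable (fun x => √(1 + ‖f x‖ ^ 2)) ν := by
  refine ((integrable_const (1 : ℝ)).add hf.norm).mono' ?_ (ae_of_all _ fun x => ?_)
  · have hc : Continuous fun v : F => √(1 + ‖v‖ ^ 2) := by fun_prop
    exact hc.comp_aestronglyMeasurable hf.aestronglyMeasurable
  · rw [Real.norm_of_nonneg (Real.sqrt_nonneg _)]
    exact sqrt_one_add_le _

variable [InnerProductSpace ℝ F]

/-- Take the convex combination, with weights 1 - ‖ψ‖ and ‖ψ‖, of the two lower bounds √(1 + ‖A‖²) -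
‖b‖ and ‖b‖ - ‖A‖, then use ⟪ψ, b⟫ ≤ ‖ψ‖ ‖b‖. -/
lemma sqrt_one_add_add_ge (A b ψ : F) (hψ : ‖ψ‖ ≤ 1) :
    √(1 + ‖A‖ ^ 2) + 2 * inner ℝ ψ b - ‖b‖ - ‖ψ‖ * (1 + 2 * ‖A‖) ≤ √(1 + ‖A + b‖ ^ 2) := by
  have h1 : √(1 + ‖A‖ ^ 2) - ‖b‖ ≤ √(1 + ‖A + b‖ ^ 2) := by
    have := sqrt_one_add_sub_le A (A + b)
    rw [sub_add_cancel_left, norm_neg] at this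
    linarith
  have h2 : ‖b‖ - ‖A‖ ≤ √(1 + ‖A + b‖ ^ 2) := by
    have h3 := norm_le_sqrt_one_add (A + b)
    have h4 : ‖b‖ ≤ ‖A + b‖ + ‖A‖ := by simpa using norm_sub_le (A + b) A
    linarith
  have h5 := sqrt_one_add_le A
  have h6 : inner ℝ ψ b ≤ ‖ψ‖ * ‖b‖ := real_inner_le_norm _ _
  have h7 := norm_nonneg ψ
  nlinarith [mul_le_mul_of_nonneg_left h2 h7,
    mul_le_mul_of_nonneg_left h1 (sub_nonneg.2 hψ), mul_le_mul_of_nonneg_left h5 h7]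


/-- A singular density is almost normed by a continuous field which is small with respect to a
given absolutely continuous measure. -/
lemma exists_norming_field {τ : Measure (Euc n)} {h : Euc n → F} (hh : Integrable h τ)
    (hτ : τ ⟂ₘ volume) {S : Set (Euc n)} {p : Euc n → ℝ} (hp : IntegrableOn p S)
    (hp0 : ∀ x, 0 ≤ p x) {δ : ℝ} (hδ : 0 < δ) :
    ∃ ψ : Euc n → F, Continuous ψ ∧ HasCompactSupport ψ ∧ (∀ x, ‖ψ x‖ ≤ 1) ∧
      ∫ x in S, ‖ψ x‖ * p x ≤ δ ∧ (∫ x, ‖h x‖ ∂τ) - δ ≤ ∫ x, inner ℝ (ψ x) (h x) ∂τ := by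
  set ρ₁ : Measure (Euc n) := τ.withDensity fun x => ‖h x‖ₑ with hρ₁
  set ρ₂ : Measure (Euc n) := (volume.restrict S).withDensity fun x => ENNReal.ofReal (p x) with hρ₂
  have hfin₁ : IsFiniteMeasure ρ₁ := ⟨by simpa [hρ₁] using! hh.2⟩
  have hfin₂ : IsFiniteMeasure ρ₂ := by
    have := isFiniteMeasure_withDensity_ofReal hp.2
    exact this
  have c₁ : ∀ f : Euc n → ℝ, ∫ x, f x ∂ρ₁ = ∫ x, ‖h x‖ * f x ∂τ := by
    intro f
    rw [hρ₁, integral_withDensity_eq_integral_toReal_smul₀ hh.aestronglyMeasurable.enorm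
      (ae_of_all _ fun x => by simp)]
    simp
  have c₂ : ∀ f : Euc n → ℝ, ∫ x, f x ∂ρ₂ = ∫ x in S, p x * f x := by
    intro f
    rw [hρ₂, integral_withDensity_eq_integral_toReal_smul₀
      hp.aestronglyMeasurable.aemeasurable.ennreal_ofReal
      (ae_of_all _ fun x => by simp)]
    simp [ENNReal.toReal_ofReal (hp0 _)]
  set N : Set (Euc n) := hτ.nullSetᶜ with hN
  have hNm : MeasurableSet N := hτ.measurableSet_nullSet.compl
  -- The polar direction of h, cut off to a Lebesgue-null set carrying τ. Approximating Θ in L¹(ρ₁ +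
  -- ρ₂) thus approximates the direction for ‖h‖ τ and zero for p dx simultaneously.
  set Θ : Euc n → F := N.indicator fun x => ‖h x‖⁻¹ • h x with hΘ
  have hΘ1 : ∀ x, ‖Θ x‖ ≤ 1 := fun x => by
    by_cases hx : x ∈ N
    · simp only [hΘ, Set.indicator_of_mem hx, norm_smul, norm_inv, norm_norm]
      exact inv_mul_le_one
    · simp [hΘ, hx]
  have hΘτ : ∀ᵐ x ∂τ, Θ x = ‖h x‖⁻¹ • h x := by
    filter_upwards [measure_eq_zero_iff_ae_notMem.1 hτ.measure_nullSet] with x hx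
    have hx' : x ∈ N := hx
    simp [hΘ, hx']
  have hΘv : ∀ᵐ x ∂(volume : Measure (Euc n)), Θ x = 0 := by
    have : ∀ᵐ x ∂(volume : Measure (Euc n)), x ∉ N :=
      measure_eq_zero_iff_ae_notMem.1 hτ.measure_compl_nullSet
    filter_upwards [this] with x hx
    simp [hΘ, hx]
  have hac₂ : ρ₂ ≪ (volume : Measure (Euc n)) :=
    (withDensity_absolutelyContinuous _ _).trans Measure.absolutelyContinuous_restrict
  have hΘm : AEStronglyMeasurable Θ (ρ₁ + ρ₂) := by
    rw [aestronglyMeasurable_add_measure_iff]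
    constructor
    · refine AEStronglyMeasurable.mono_ac (withDensity_absolutelyContinuous _ _) ?_
      exact (hh.aestronglyMeasurable.norm.inv₀.smul hh.aestronglyMeasurable).indicator hNm
    · refine AEStronglyMeasurable.congr (f := 0) aestronglyMeasurable_const ?_
      filter_upwards [hac₂.ae_le hΘv] with x hx
      exact hx.symm
  have hΘi : Integrable Θ (ρ₁ + ρ₂) := Integrable.of_bound hΘm 1 (ae_of_all _ hΘ1)
  obtain ⟨ψ₀, hψ₀s, hψ₀, hψ₀c, hψ₀i⟩ := hΘi.exists_hasCompactSupport_integral_sub_le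
    (show 0 < δ / 2 by positivity)
  -- Radial retraction of ψ₀ onto the unit ball; as ‖Θ‖ ≤ 1, this at most doubles the distance to Θ,
  -- which explains δ / 2 above.
  set ψ : Euc n → F := fun x => (max 1 ‖ψ₀ x‖)⁻¹ • ψ₀ x with hψ
  have hpos : ∀ x, 0 < max 1 ‖ψ₀ x‖ := fun x => lt_max_of_lt_left one_pos
  have hψc : Continuous ψ := by
    refine Continuous.smul (Continuous.inv₀ (by fun_prop) fun x => (hpos x).ne') hψ₀c
  have hψs : HasCompactSupport ψ := hψ₀s.smul_left
  have hψ1 : ∀ x, ‖ψ x‖ ≤ 1 := fun x => by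
    simp only [hψ, norm_smul, norm_inv, Real.norm_of_nonneg (hpos x).le]
    rw [inv_mul_le_iff₀ (hpos x), mul_one]
    exact le_max_right _ _
  have hclose : ∀ x, ‖ψ x - Θ x‖ ≤ 2 * ‖Θ x - ψ₀ x‖ := fun x => by
    have h1 : ‖ψ x - ψ₀ x‖ ≤ ‖Θ x - ψ₀ x‖ := by
      rcases le_total ‖ψ₀ x‖ 1 with hle | hle
      · simp [hψ, max_eq_left hle]
      · have e1 : ψ x - ψ₀ x = (‖ψ₀ x‖⁻¹ - 1) • ψ₀ x := by
          simp only [hψ, max_eq_right hle, sub_smul, one_smul]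
        have hinv : ‖ψ₀ x‖⁻¹ ≤ 1 := inv_le_one_of_one_le₀ hle
        have hne : ‖ψ₀ x‖ ≠ 0 := by linarith
        rw [e1, norm_smul, Real.norm_of_nonpos (by linarith), neg_sub, sub_mul,
          inv_mul_cancel₀ hne, one_mul, norm_sub_rev]
        linarith [norm_sub_norm_le (ψ₀ x) (Θ x), hΘ1 x]
    have h2 : ψ x - Θ x = (ψ x - ψ₀ x) - (Θ x - ψ₀ x) := by abel
    rw [h2]
    linarith [norm_sub_le (ψ x - ψ₀ x) (Θ x - ψ₀ x)]
  have hψi : Integrable (fun x => ‖ψ x - Θ x‖) (ρ₁ + ρ₂) :=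
    ((hψc.integrable_of_hasCompactSupport hψs).sub hΘi).norm
  have htot : ∫ x, ‖ψ x - Θ x‖ ∂(ρ₁ + ρ₂) ≤ δ := by
    calc _ ≤ ∫ x, 2 * ‖Θ x - ψ₀ x‖ ∂(ρ₁ + ρ₂) :=
          integral_mono hψi ((hΘi.sub hψ₀i).norm.const_mul 2) hclose
      _ = 2 * ∫ x, ‖Θ x - ψ₀ x‖ ∂(ρ₁ + ρ₂) := integral_const_mul _ _
      _ ≤ δ := by linarith
  rw [integral_add_measure hψi.left_of_add_measure hψi.right_of_add_measure, c₁, c₂] at htot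
  have hnn₁ : 0 ≤ ∫ x, ‖h x‖ * ‖ψ x - Θ x‖ ∂τ := integral_nonneg fun x => by positivity
  have hnn₂ : 0 ≤ ∫ x in S, p x * ‖ψ x - Θ x‖ :=
    integral_nonneg fun x => mul_nonneg (hp0 x) (norm_nonneg _)
  refine ⟨ψ, hψc, hψs, hψ1, ?_, ?_⟩
  · have : ∫ x in S, ‖ψ x‖ * p x = ∫ x in S, p x * ‖ψ x - Θ x‖ := by
      refine integral_congr_ae (ae_restrict_of_ae ?_)
      filter_upwards [hΘv] with x hx
      rw [hx, sub_zero, mul_comm]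
    linarith
  · have hi1 : Integrable (fun x => ‖h x‖ * ‖ψ x - Θ x‖) τ := by
      have hm : AEStronglyMeasurable Θ τ :=
        (hh.aestronglyMeasurable.norm.inv₀.smul hh.aestronglyMeasurable).indicator hNm
      refine (hh.norm.mul_const 2).mono' (hh.aestronglyMeasurable.norm.mul
        (hψc.aestronglyMeasurable.sub hm).norm) (ae_of_all _ fun x => ?_)
      rw [Real.norm_of_nonneg (by positivity)]
      gcongr
      linarith [norm_sub_le (ψ x) (Θ x), hψ1 x, hΘ1 x]
    have hi2 : Integrable (fun x => inner ℝ (ψ x) (h x)) τ := by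
      refine hh.norm.mono' (hψc.aestronglyMeasurable.inner hh.aestronglyMeasurable)
        (ae_of_all _ fun x => ?_)
      refine (norm_inner_le_norm _ _).trans ?_
      simpa using mul_le_mul_of_nonneg_right (hψ1 x) (norm_nonneg (h x))
    have hmono : ∫ x, ‖h x‖ - ‖h x‖ * ‖ψ x - Θ x‖ ∂τ ≤ ∫ x, inner ℝ (ψ x) (h x) ∂τ := by
      refine integral_mono_ae (hh.norm.sub hi1) hi2 ?_
      filter_upwards [hΘτ] with x hx
      have h1 : inner ℝ (Θ x) (h x) = ‖h x‖ := by
        rw [hx, inner_smul_left, real_inner_self_eq_norm_sq]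
        rcases eq_or_ne (h x) 0 with h0 | h0
        · simp [h0]
        · have : ‖h x‖ ≠ 0 := norm_ne_zero_iff.2 h0
          simp only [conj_trivial]
          field_simp
      have h2 : inner ℝ (ψ x) (h x) = inner ℝ (Θ x) (h x) + inner ℝ (ψ x - Θ x) (h x) := by
        rw [inner_sub_left]
        ring
      have h3 := (abs_le.1 (abs_real_inner_le_norm (ψ x - Θ x) (h x))).1
      rw [h2, h1]
      linarith [mul_comm ‖h x‖ ‖ψ x - Θ x‖]
    rw [integral_sub hh.norm hi1] at hmono
    linarith

/-- Convergence of the area of `A + dⱼ + bⱼ` when `dⱼ → 0` in `L¹` and `bⱼ` converges weakly to a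
singular measure without excess mass. -/
lemma tendsto_integral_sqrt {τ : Measure (Euc n)} {h : Euc n → F} (hh : Integrable h τ)
    (hτ : τ ⟂ₘ volume) {S : Set (Euc n)} (hS : volume S ≠ ⊤)
    {A : Euc n → F} (hA : Integrable A) {d b : ℕ → Euc n → F} (hd : ∀ j, Integrable (d j))
    (hb : ∀ j, Integrable (b j)) (hd0 : Tendsto (fun j => ∫ x, ‖d j x‖) atTop (𝓝 0))
    (hbh : ∀ j, ∫ x, ‖b j x‖ ≤ ∫ x, ‖h x‖ ∂τ) (hbS : ∀ j x, x ∉ S → b j x = 0)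
    (hweak : ∀ ψ : Euc n → F, Continuous ψ → HasCompactSupport ψ →
      Tendsto (fun j => ∫ x, inner ℝ (ψ x) (b j x)) atTop (𝓝 (∫ x, inner ℝ (ψ x) (h x) ∂τ))) :
    Tendsto (fun j => ∫ x in S, √(1 + ‖A x + d j x + b j x‖ ^ 2)) atTop
      (𝓝 ((∫ x in S, √(1 + ‖A x‖ ^ 2)) + ∫ x, ‖h x‖ ∂τ)) := by
  have : IsFiniteMeasure (volume.restrict S : Measure (Euc n)) := ⟨by
    rw [Measure.restrict_apply_univ]; exact hS.lt_top⟩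
  set H := ∫ x, ‖h x‖ ∂τ
  set I := ∫ x in S, √(1 + ‖A x‖ ^ 2)
  have hAS : IntegrableOn A S := hA.integrableOn
  have hIA := integrable_sqrt_one_add hAS
  have hIj : ∀ j, IntegrableOn (fun x => √(1 + ‖A x + d j x + b j x‖ ^ 2)) S := fun j =>
    integrable_sqrt_one_add ((hA.add (hd j)).add (hb j)).integrableOn
  have hdS : ∀ j, ∫ x in S, ‖d j x‖ ≤ ∫ x, ‖d j x‖ := fun j =>
    setIntegral_le_integral (hd j).norm (ae_of_all _ fun x => norm_nonneg _)
  have hbS' : ∀ j, ∫ x in S, ‖b j x‖ ≤ H := fun j =>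
    (setIntegral_le_integral (hb j).norm (ae_of_all _ fun x => norm_nonneg _)).trans (hbh j)
  have hupper : ∀ j, ∫ x in S, √(1 + ‖A x + d j x + b j x‖ ^ 2) ≤ I + H + ∫ x, ‖d j x‖ := by
    intro j
    have i1 : IntegrableOn (fun x => ‖d j x‖) S := (hd j).norm.integrableOn
    have i2 : IntegrableOn (fun x => ‖b j x‖) S := (hb j).norm.integrableOn
    have i3 : IntegrableOn (fun x => √(1 + ‖A x‖ ^ 2) + ‖d j x‖) S := hIA.add i1
    have h1 : ∫ x in S, √(1 + ‖A x + d j x + b j x‖ ^ 2) ≤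
        ∫ x in S, √(1 + ‖A x‖ ^ 2) + ‖d j x‖ + ‖b j x‖ := by
      refine integral_mono (hIj j) (i3.add i2) fun x => ?_
      have h2 := sqrt_one_add_sub_le (A x + d j x + b j x) (A x)
      have h3 : A x + d j x + b j x - A x = d j x + b j x := by abel
      rw [h3] at h2
      simp only
      linarith [norm_add_le (d j x) (b j x)]
    rw [integral_add i3 i2, integral_add hIA i1] at h1
    linarith [hdS j, hbS' j]
  have hlower : ∀ ψ : Euc n → F, Continuous ψ → HasCompactSupport ψ → (∀ x, ‖ψ x‖ ≤ 1) → ∀ j,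
      I + 2 * (∫ x, inner ℝ (ψ x) (b j x)) - H - (∫ x in S, ‖ψ x‖ * (1 + 2 * ‖A x‖)) -
        ∫ x, ‖d j x‖ ≤ ∫ x in S, √(1 + ‖A x + d j x + b j x‖ ^ 2) := by
    intro ψ hψc hψs hψ1 j
    have hψb : Integrable (fun x => inner ℝ (ψ x) (b j x)) := by
      refine (hb j).norm.mono' (hψc.aestronglyMeasurable.inner (hb j).aestronglyMeasurable)
        (ae_of_all _ fun x => ?_)
      refine (norm_inner_le_norm _ _).trans ?_
      simpa using mul_le_mul_of_nonneg_right (hψ1 x) (norm_nonneg (b j x))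
    have i1 : IntegrableOn (fun x => ‖d j x‖) S := (hd j).norm.integrableOn
    have i2 : IntegrableOn (fun x => ‖b j x‖) S := (hb j).norm.integrableOn
    have i3 : IntegrableOn (fun x => 2 * inner ℝ (ψ x) (b j x)) S :=
      (hψb.const_mul 2).integrableOn
    have i4 : IntegrableOn (fun x => ‖ψ x‖ * (1 + 2 * ‖A x‖)) S := by
      refine Integrable.mono' (g := fun x => 1 + 2 * ‖A x‖)
        ((integrable_const 1).add (hAS.norm.const_mul 2))
        (hψc.norm.aestronglyMeasurable.mul
          (aestronglyMeasurable_const.add (hAS.aestronglyMeasurable.norm.const_mul 2)))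
        (ae_of_all _ fun x => ?_)
      rw [Real.norm_of_nonneg (by positivity)]
      exact mul_le_of_le_one_left (by positivity) (hψ1 x)
    have e1 : ∫ x in S, 2 * inner ℝ (ψ x) (b j x) = 2 * ∫ x, inner ℝ (ψ x) (b j x) := by
      rw [integral_const_mul, setIntegral_eq_integral_of_forall_compl_eq_zero]
      intro x hx
      rw [hbS j x hx, inner_zero_right]
    have j1 : IntegrableOn (fun x => √(1 + ‖A x‖ ^ 2) + 2 * inner ℝ (ψ x) (b j x)) S := hIA.add i3
    have j2 : IntegrableOn (fun x => √(1 + ‖A x‖ ^ 2) + 2 * inner ℝ (ψ x) (b j x) - ‖b j x‖) S :=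
      j1.sub i2
    have j3 : IntegrableOn (fun x => √(1 + ‖A x‖ ^ 2) + 2 * inner ℝ (ψ x) (b j x) - ‖b j x‖ -
      ‖ψ x‖ * (1 + 2 * ‖A x‖)) S := j2.sub i4
    have h1 : ∫ x in S, √(1 + ‖A x‖ ^ 2) + 2 * inner ℝ (ψ x) (b j x) - ‖b j x‖ -
        ‖ψ x‖ * (1 + 2 * ‖A x‖) - ‖d j x‖ ≤ ∫ x in S, √(1 + ‖A x + d j x + b j x‖ ^ 2) := by
      refine integral_mono (j3.sub i1) (hIj j) fun x => ?_
      have h2 := sqrt_one_add_add_ge (A x) (b j x) (ψ x) (hψ1 x)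
      have h3 := sqrt_one_add_sub_le (A x + b j x) (A x + d j x + b j x)
      have h4 : A x + b j x - (A x + d j x + b j x) = -d j x := by abel
      rw [h4, norm_neg] at h3
      simp only
      linarith
    rw [integral_sub j3 i1, integral_sub j2 i4, integral_sub j1 i2, integral_add hIA i3, e1] at h1
    linarith [hdS j, hbS' j]
  rw [tendsto_order]
  constructor
  · intro c hc
    -- The lower bound loses 2(δ + δ/2) through the weak limit and the norming defect, δ through the
    -- smallness of ψ, and δ through d_j: 5δ in all.
    set δ : ℝ := (I + H - c) / 5 with hδ
    have hδ0 : 0 < δ := by rw [hδ]; linarith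
    obtain ⟨ψ, hψc, hψs, hψ1, hψA, hψh⟩ := exists_norming_field hh hτ (S := S)
      (p := fun x => 1 + 2 * ‖A x‖) ((integrable_const 1).add (hAS.norm.const_mul 2))
      (fun x => by positivity) hδ0
    have hev1 : ∀ᶠ j in atTop, (∫ x, inner ℝ (ψ x) (h x) ∂τ) - δ / 2 < ∫ x, inner ℝ (ψ x) (b j x) :=
      (hweak ψ hψc hψs).eventually (lt_mem_nhds (by linarith))
    have hev2 : ∀ᶠ j in atTop, ∫ x, ‖d j x‖ < δ := hd0.eventually (gt_mem_nhds hδ0)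
    filter_upwards [hev1, hev2] with j h1 h2
    have h3 := hlower ψ hψc hψs hψ1 j
    have h4 : c = I + H - 5 * δ := by rw [hδ]; ring
    linarith
  · intro c hc
    have hev : ∀ᶠ j in atTop, ∫ x, ‖d j x‖ < c - (I + H) :=
      hd0.eventually (gt_mem_nhds (by linarith))
    filter_upwards [hev] with j hj
    linarith [hupper j]

end areaLimit

end FractionalBV

/-! ### Uniqueness, vanishing mollification errors and locality of the singular part -/

namespace FractionalBV

variable {n m : ℕ} {α : ℝ}

section uniqueness

variable {u v : Euc n → Euc m} {a b h k : Euc n → Mat m n} {τ : Measure (Euc n)}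

lemma HasVariation.congr (H : HasVariation α u a τ h) (huv : u =ᵐ[volume] v) :
    HasVariation α v a τ h where
  integrable := H.integrable.congr huv
  integrable_ac := H.integrable_ac
  integrable_sing := H.integrable_sing
  integral_eq φ hφ := by
    rw [← H.integral_eq φ hφ]
    refine integral_congr_ae ?_
    filter_upwards [huv] with x hx
    rw [hx]

lemma HasVariation.zero : HasVariation α (0 : Euc n → Euc m) 0 τ 0 where
  integrable := integrable_zero _ _ _
  integrable_ac := integrable_zero _ _ _
  integrable_sing := integrable_zero _ _ _
  integral_eq φ hφ := by simp

lemma HasVariation.unique (hτ : τ ⟂ₘ volume) (H : HasVariation α u a τ h)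
    (H' : HasVariation α u b τ k) [IsFiniteMeasure τ] : a =ᵐ[volume] b ∧ h =ᵐ[τ] k := by
  have he := H.fracVariation_eq.symm.trans H'.fracVariation_eq
  refine ⟨(acDensity_ae_eq H.integrable_ac H.integrable_sing hτ).symm.trans ?_, ?_⟩
  · rw [he]
    exact acDensity_ae_eq H'.integrable_ac H'.integrable_sing hτ
  · refine H.integrable_sing.ae_eq_of_withDensityᵥ_eq H'.integrable_sing ?_
    rw [← singPart_eq H.integrable_ac H.integrable_sing hτ, he,
      singPart_eq H'.integrable_ac H'.integrable_sing hτ]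

end uniqueness

section smear

variable {F : Type*} [NormedAddCommGroup F]

lemma IsMollifier.mono {δ ε : ℝ} {η : Euc n → ℝ} (hη : IsMollifier δ η) (h : δ ≤ ε) :
    IsMollifier ε η :=
  ⟨hη.test, hη.nonneg, hη.integral_eq_one, fun z hz => (hη.norm_le z hz).trans h⟩

lemma smear_eq_zero [NormedSpace ℝ F] {η χ : Euc n → ℝ} {τ : Measure (Euc n)} {h : Euc n → F}
    {S C : Set (Euc n)} (hS : ∀ᵐ y ∂τ, y ∉ S → h y = 0)
    (hC : ∀ y ∈ S, χ y ≠ 0 → ∀ x, η (x - y) ≠ 0 → x ∈ C) {x : Euc n} (hx : x ∉ C) :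
    smear η τ (fun y => χ y • h y) x = 0 := by
  refine integral_eq_zero_of_ae ?_
  filter_upwards [hS] with y hy
  by_cases hyS : y ∈ S
  · by_cases hχ : χ y = 0
    · simp [hχ]
    · have : η (x - y) = 0 := by
        by_contra h0
        exact hx (hC y hyS hχ x h0)
      simp [this]
  · simp [hy hyS]

lemma tendsto_integral_smear_sub [NormedSpace ℝ F] [CompleteSpace F] {ι : Type*} [Fintype ι]
    {f : ι → Euc n → F} (hf : ∀ i, Integrable (f i)) {δ : ℕ → ℝ} (hδ : Tendsto δ atTop (𝓝 0))
    {η : ℕ → ι → Euc n → ℝ} (hη : ∀ j i, IsMollifier (δ j) (η j i)) :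
    Tendsto (fun j => ∫ x, ‖∑ i, smear (η j i) volume (f i) x - ∑ i, f i x‖) atTop (𝓝 0) := by
  have h1 : ∀ i, Tendsto (fun j => ∫ x, ‖smear (η j i) volume (f i) x - f i x‖) atTop (𝓝 0) := by
    intro i
    rw [Metric.tendsto_atTop']
    intro ε hε
    obtain ⟨r, hr, h⟩ := exists_smear_sub_le (hf i) (half_pos hε)
    obtain ⟨N, hN⟩ := eventually_atTop.1 (hδ.eventually (gt_mem_nhds hr))
    refine ⟨N, fun j hj => ?_⟩
    have := h _ ((hη j i).mono (hN j hj.le).le)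
    rw [dist_zero_right, Real.norm_of_nonneg (integral_nonneg fun x => norm_nonneg _)]
    linarith
  have hi : ∀ j i, Integrable fun x => ‖smear (η j i) volume (f i) x - f i x‖ := fun j i =>
    ((integrable_smear (hη j i).test (hf i)).sub (hf i)).norm
  have h2 := tendsto_finsetSum Finset.univ fun i _ => h1 i
  simp only [Finset.sum_const_zero] at h2
  refine squeeze_zero (fun j => integral_nonneg fun x => norm_nonneg _) (fun j => ?_) h2
  rw [← integral_finsetSum _ fun i _ => hi j i]
  refine integral_mono_of_nonneg (ae_of_all _ fun x => norm_nonneg _)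
    (integrable_finsetSum _ fun i _ => hi j i) (ae_of_all _ fun x => ?_)
  simp only [← Finset.sum_sub_distrib]
  exact norm_sum_le _ _

lemma IsMollifier.norm_corr_sub_le [NormedSpace ℝ F] [CompleteSpace F] {δ ε : ℝ} {η : Euc n → ℝ}
    (hη : IsMollifier δ η) {ψ : Euc n → F} (hψ : Continuous ψ)
    (h : ∀ x y, ‖x - y‖ ≤ δ → ‖ψ x - ψ y‖ ≤ ε) (y : Euc n) : ‖corr η ψ y - ψ y‖ ≤ ε := by
  have hi : Integrable fun z => η z • ψ (y + z) :=
    (hη.test.1.continuous.smul (by fun_prop)).integrable_of_hasCompactSupport hη.test.2.1.smul_right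
  have hi' : Integrable fun z => η z • ψ y := hη.test.integrable.smul_const _
  have : corr η ψ y - ψ y = ∫ z, η z • (ψ (y + z) - ψ y) := by
    simp only [smul_sub]
    rw [integral_sub hi hi', integral_smul_const, hη.integral_eq_one, one_smul, corr]
  rw [this]
  refine (norm_integral_le_integral_norm _).trans ?_
  calc ∫ z, ‖η z • (ψ (y + z) - ψ y)‖ ≤ ∫ z, η z * ε := by
        refine integral_mono_of_nonneg (ae_of_all _ fun x => norm_nonneg _)
          (hη.test.integrable.mul_const _) (ae_of_all _ fun z => ?_)
        simp only [norm_smul, Real.norm_of_nonneg (hη.nonneg z)]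
        by_cases hz : η z = 0
        · simp [hz]
        · exact mul_le_mul_of_nonneg_left (h _ _ (by simpa using hη.norm_le z hz)) (hη.nonneg z)
    _ = ε := by rw [integral_mul_const, hη.integral_eq_one, one_mul]

/-- By adjointness the mollifier falls on ψ, whose correlations converge uniformly to ψ; only the
radii of the mollifiers matter. -/
lemma tendsto_integral_inner_smear [InnerProductSpace ℝ F] [CompleteSpace F] {τ : Measure (Euc n)}
    [SFinite τ] {k : Euc n → F} (hk : Integrable k τ) {δ : ℕ → ℝ} (hδ : Tendsto δ atTop (𝓝 0))
    {η : ℕ → Euc n → ℝ} (hη : ∀ j, IsMollifier (δ j) (η j)) {ψ : Euc n → F} (hψ : Continuous ψ)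
    (hψc : HasCompactSupport ψ) :
    Tendsto (fun j => ∫ x, inner ℝ (ψ x) (smear (η j) τ k x)) atTop
      (𝓝 (∫ x, inner ℝ (ψ x) (k x) ∂τ)) := by
  obtain ⟨B, hB⟩ := hψc.exists_bound_of_continuous hψ
  set M := ∫ x, ‖k x‖ ∂τ with hM
  have hM0 : 0 ≤ M := integral_nonneg fun x => norm_nonneg _
  rw [Metric.tendsto_atTop']
  intro ε hε
  have hε' : 0 < ε / (M + 1) / 2 := by positivity
  obtain ⟨r, hr, huc⟩ := Metric.uniformContinuous_iff.1
    (hψc.uniformContinuous_of_continuous hψ) _ hε'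
  obtain ⟨N, hN⟩ := eventually_atTop.1 (hδ.eventually (gt_mem_nhds hr))
  refine ⟨N, fun j hj => ?_⟩
  have hc : ∀ y, ‖corr (η j) ψ y - ψ y‖ ≤ ε / (M + 1) / 2 := by
    refine (hη j).norm_corr_sub_le hψ fun x y hxy => ?_
    have := huc (a := x) (b := y) (by rw [dist_eq_norm]; exact hxy.trans_lt (hN j hj.le))
    rw [dist_eq_norm] at this
    exact this.le
  have hcc : Continuous (corr (η j) ψ) := by
    have : corr (η j) ψ = smear (fun z => η j (-z)) volume ψ := by
      funext y
      rw [corr_eq, smear]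
      simp
    rw [this]
    exact (contDiff_smear (isTestFunction_neg (hη j).test)
      (hψ.integrable_of_hasCompactSupport hψc)).continuous
  have hi : ∀ (f : Euc n → F) (D : ℝ), Continuous f → (∀ x, ‖f x‖ ≤ D) →
      Integrable (fun x => inner ℝ (f x) (k x)) τ := by
    intro f D hf hD
    refine (hk.norm.const_mul D).mono' (hf.aestronglyMeasurable.inner hk.aestronglyMeasurable)
      (ae_of_all _ fun x => ?_)
    exact (norm_inner_le_norm _ _).trans (mul_le_mul_of_nonneg_right (hD x) (norm_nonneg _))
  rw [integral_inner_smear (hη j).test hk hψ.aestronglyMeasurable hB, dist_eq_norm,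
    ← integral_sub (hi _ (ε / (M + 1) / 2 + B) hcc fun x => ?_) (hi _ B hψ hB)]
  · simp only [← inner_sub_left]
    calc ‖∫ x, inner ℝ (corr (η j) ψ x - ψ x) (k x) ∂τ‖
        ≤ ∫ x, ε / (M + 1) / 2 * ‖k x‖ ∂τ := by
          refine norm_integral_le_of_norm_le (hk.norm.const_mul _) (ae_of_all _ fun x => ?_)
          exact (norm_inner_le_norm _ _).trans (mul_le_mul_of_nonneg_right (hc x) (norm_nonneg _))
      _ = ε / (M + 1) / 2 * M := by rw [integral_const_mul]
      _ < ε := by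
          rw [div_div, div_mul_eq_mul_div, div_lt_iff₀ (by positivity)]
          nlinarith
  · have := norm_add_le (corr (η j) ψ x - ψ x) (ψ x)
    rw [sub_add_cancel] at this
    linarith [hc x, hB x]

end smear

section support

variable (hn : 1 ≤ n) (hα₀ : 0 < α) (hα₁ : α < 1)
include hn hα₀ hα₁

/-- The singular density is zero, so any τ may stand in the decomposition of g; it can be matched
with the τ of u - g when the two are added. -/
lemma MemS.exists_hasVariation {u : Euc n → Euc m} (hu : MemS α u) :
    ∃ a : Euc n → Mat m n, ∀ τ : Measure (Euc n), HasVariation α u a τ 0 := by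
  obtain ⟨a, τ, h, hτf, hτ, H⟩ := hu.1.exists_hasVariation hn hα₀ hα₁
  have h0 : τ.withDensityᵥ h = τ.withDensityᵥ (0 : Euc n → Mat m n) := by
    rw [withDensityᵥ_zero, ← singPart_eq H.integrable_ac H.integrable_sing hτ,
      ← H.fracVariation_eq, hu.2]
  have h0' := H.integrable_sing.ae_eq_of_withDensityᵥ_eq (integrable_zero _ _ _) h0
  refine ⟨a, fun τ' => ⟨H.integrable, H.integrable_ac, integrable_zero _ _ _, fun φ hφ => ?_⟩⟩
  rw [H.integral_eq φ hφ]
  congr 2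
  trans 0
  · refine integral_eq_zero_of_ae ?_
    filter_upwards [h0'] with x hx
    simp [hx]
  · simp

/-- Although `D^α` is nonlocal, the singular part of `D^α w` does not charge open sets on which `w`
vanishes. -/
lemma HasVariation.sing_eq_zero {w : Euc n → Euc m} {a h : Euc n → Mat m n}
    {τ : Measure (Euc n)} [IsFiniteMeasure τ] (hτ : τ ⟂ₘ volume) (H : HasVariation α w a τ h)
    {U : Set (Euc n)} (hU : IsOpen U) (hw : ∀ᵐ x ∂(volume : Measure (Euc n)), x ∈ U → w x = 0) :
    ∀ᵐ y ∂τ, y ∈ U → h y = 0 := by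
  have key : ∀ R : ℕ, ∀ᵐ y ∂τ, y ∈ U ∩ Metric.ball 0 R → h y = 0 := by
    intro R
    -- The cutoff is nonzero exactly on U inside a ball. Then f w = 0 almost everywhere, so by
    -- uniqueness the singular density f h of its variation vanishes, and f can be cancelled on U.
    -- The ball provides the compact support.
    obtain ⟨f, hfs, hf, -⟩ := (hU.inter Metric.isOpen_ball).exists_contDiff_support_eq (n := ⊤)
      (s := U ∩ Metric.ball 0 (R : ℝ))
    have hft : IsTestFunction Set.univ f := by
      refine ⟨hf, ?_, Set.subset_univ _⟩
      refine HasCompactSupport.intro (isCompact_closedBall (0 : Euc n) R) fun x hx => ?_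
      by_contra h0
      have : x ∈ Function.support f := h0
      rw [hfs] at this
      exact hx (Metric.ball_subset_closedBall this.2)
    have H1 := (H.smul hn hα₀ hα₁ hft).congr (v := 0) (by
      filter_upwards [hw] with x hx
      by_cases hxU : x ∈ U
      · simp [hx hxU]
      · have : x ∉ Function.support f := by rw [hfs]; exact fun h => hxU h.1
        simp [Function.notMem_support.1 this])
    filter_upwards [(H1.unique hτ HasVariation.zero).2] with y hy hyU
    rw [← hfs] at hyU
    exact (smul_eq_zero.1 hy).resolve_left hyU
  filter_upwards [ae_all_iff.2 key] with y hy hyU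
  obtain ⟨R, hR⟩ := exists_nat_gt ‖y‖
  exact hy R ⟨hyU, by simpa using hR⟩

end support

end FractionalBV

/-! ### Construction of the approximating sequence and conclusion -/

namespace FractionalBV

variable {n m : ℕ} {α : ℝ}

lemma isTestFunction_sum_smear {F : Type*} [NormedAddCommGroup F] [NormedSpace ℝ F]
    [CompleteSpace F] {ι : Type*} [Fintype ι] {Ω : Set (Euc n)} {η : ι → Euc n → ℝ}
    (hη : ∀ i, IsTestFunction Set.univ (η i)) {f : ι → Euc n → F} (hf : ∀ i, Integrable (f i))
    {C : ι → Set (Euc n)} (hC : ∀ i, IsCompact (C i)) (hCΩ : ∀ i, C i ⊆ Ω)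
    (h0 : ∀ i x, x ∉ C i → smear (η i) volume (f i) x = 0) :
    IsTestFunction Ω (∑ i, smear (η i) volume (f i)) := by
  have hcpt : IsCompact (⋃ i, C i) := isCompact_iUnion hC
  have hz : ∀ x, x ∉ ⋃ i, C i → (∑ i, smear (η i) volume (f i)) x = 0 := by
    intro x hx
    rw [Finset.sum_apply]
    exact Finset.sum_eq_zero fun i _ => h0 i x fun h => hx (Set.mem_iUnion.2 ⟨i, h⟩)
  refine ⟨?_, HasCompactSupport.intro hcpt hz, ?_⟩
  · have := ContDiff.sum (𝕜 := ℝ) (n := ∞) (s := Finset.univ)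
      fun i _ => contDiff_smear (hη i) (hf i)
    convert this using 1
    funext x
    rw [Finset.sum_apply]
  · refine (closure_minimal (fun x hx => ?_) hcpt.isClosed).trans (Set.iUnion_subset hCΩ)
    by_contra h
    exact hx (hz x h)

variable (hn : 1 ≤ n) (hα₀ : 0 < α) (hα₁ : α < 1)
include hn hα₀ hα₁

/-- Approximation of a function vanishing outside `Ω` by test functions: the densities of the
variations differ from the absolutely continuous part by a term vanishing in `L¹` and a
mollification of the singular part. -/
lemma exists_approximation {Ω : Set (Euc n)} (hΩ : IsBoundedLipschitzDomain Ω)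
    {w : Euc n → Euc m} (hw : MemBVZero α Ω w) :
    ∃ (a : Euc n → Mat m n) (τ : Measure (Euc n)) (h : Euc n → Mat m n)
      (φ : ℕ → Euc n → Euc m) (d b : ℕ → Euc n → Mat m n), IsFiniteMeasure τ ∧ τ ⟂ₘ volume ∧
      HasVariation α w a τ h ∧ (∀ᵐ y ∂τ, y ∉ closure Ω → h y = 0) ∧
      (∀ j, IsTestFunction Ω (φ j)) ∧ (∀ j, HasVariation α (φ j) (a + (d j + b j)) τ 0) ∧
      (∀ j, Integrable (d j)) ∧ (∀ j, Integrable (b j)) ∧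
      Tendsto (fun j => ∫ x, ‖φ j x - w x‖) atTop (𝓝 0) ∧
      Tendsto (fun j => ∫ x, ‖d j x‖) atTop (𝓝 0) ∧
      (∀ j, ∫ x, ‖b j x‖ ≤ ∫ x, ‖h x‖ ∂τ) ∧ (∀ j x, x ∉ Ω → b j x = 0) ∧
      ∀ ψ : Euc n → Mat m n, Continuous ψ → HasCompactSupport ψ →
        Tendsto (fun j => ∫ x, inner ℝ (ψ x) (b j x)) atTop
          (𝓝 (∫ x, inner ℝ (ψ x) (h x) ∂τ)) := by
  obtain ⟨a, τ, h, hτf, hτ, H⟩ := hw.1.exists_hasVariation hn hα₀ hα₁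
  obtain ⟨ι, _, χ, hχ, hχ0, hχ1, hη⟩ := hΩ.exists_partition
  have hwS : ∀ᵐ x ∂(volume : Measure (Euc n)), x ∉ closure Ω → w x = 0 := by
    filter_upwards [hw.2] with x hx hxS
    exact hx fun h => hxS (subset_closure h)
  have hhS : ∀ᵐ y ∂τ, y ∉ closure Ω → h y = 0 :=
    H.sing_eq_zero hn hα₀ hα₁ hτ isClosed_closure.isOpen_compl hwS
  set δ : ℕ → ℝ := fun j => 1 / ((j : ℝ) + 1) with hδ
  have hδ0 : Tendsto δ atTop (𝓝 0) := tendsto_one_div_add_atTop_nhds_zero_nat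
  choose η hηm C hC hCΩ hCη using fun (j : ℕ) (i : ι) => hη i (δ j) Nat.one_div_pos_of_nat
  have Hi : ∀ i, HasVariation α (fun x => χ i x • w x)
      (fun x => χ i x • a x + leibnizTerm α (χ i) w x) τ (fun x => χ i x • h x) := fun i =>
    H.smul hn hα₀ hα₁ (hχ i)
  set f : ι → Euc n → Euc m := fun i x => χ i x • w x with hf
  set A : ι → Euc n → Mat m n := fun i x => χ i x • a x + leibnizTerm α (χ i) w x with hA
  set k : ι → Euc n → Mat m n := fun i x => χ i x • h x with hk
  have hfw : ∀ᵐ x ∂(volume : Measure (Euc n)), ∑ i, f i x = w x := by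
    filter_upwards [hwS] with x hx
    by_cases hxS : x ∈ closure Ω
    · simp only [hf, ← Finset.sum_smul, hχ1 x hxS, one_smul]
    · simp [hf, hx hxS]
  have hkh : ∀ᵐ x ∂τ, ∑ i, k i x = h x := by
    filter_upwards [hhS] with x hx
    by_cases hxS : x ∈ closure Ω
    · simp only [hk, ← Finset.sum_smul, hχ1 x hxS, one_smul]
    · simp [hk, hx hxS]
  -- The pieces χ_i w add up to w, so uniqueness of the decomposition makes their absolutely
  -- continuous densities add up to a; the Leibniz corrections need not be summed by hand.
  have hAa : ∀ᵐ x ∂(volume : Measure (Euc n)), ∑ i, A i x = a x := by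
    have H' := (HasVariation.sum hn hα₀ hα₁ Finset.univ fun i _ => Hi i).congr (v := w) (by
      filter_upwards [hfw] with x hx
      simpa using hx)
    filter_upwards [(H'.unique hτ H).1] with x hx
    simpa using hx
  have hfi : ∀ i, Integrable (f i) := fun i => (Hi i).integrable
  have hAi : ∀ i, Integrable (A i) := fun i => (Hi i).integrable_ac
  have hki : ∀ i, Integrable (k i) τ := fun i => (Hi i).integrable_sing
  refine ⟨a, τ, h, fun j => ∑ i, smear (η j i) volume (f i),
    fun j => ∑ i, smear (η j i) volume (A i) - a, fun j => ∑ i, smear (η j i) τ (k i),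
    hτf, hτ, H, hhS, fun j => ?_, fun j => ?_, fun j => ?_, fun j => ?_, ?_, ?_, fun j => ?_,
    fun j x hx => ?_, fun ψ hψ hψc => ?_⟩
  · exact isTestFunction_sum_smear (fun i => (hηm j i).test) hfi (hC j) (hCΩ j)
      fun i x hx => smear_eq_zero hwS (hCη j i) hx
  · have H' := HasVariation.sum hn hα₀ hα₁ Finset.univ
      fun i _ => (Hi i).smear hn hα₀ hα₁ (hηm j i).test
    rw [Finset.sum_add_distrib, Finset.sum_const_zero] at H'
    have he : a + (∑ i, smear (η j i) volume (A i) - a + ∑ i, smear (η j i) τ (k i)) =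
        ∑ i, smear (η j i) volume (A i) + ∑ i, smear (η j i) τ (k i) := by
      rw [← add_assoc, add_sub_cancel]
    change HasVariation α (∑ i, smear (η j i) volume (f i))
      (a + (∑ i, smear (η j i) volume (A i) - a + ∑ i, smear (η j i) τ (k i))) τ 0
    rw [he]
    exact H'
  · exact (integrable_finsetSum' _ fun i _ => integrable_smear (hηm j i).test (hAi i)).sub
      H.integrable_ac
  · exact integrable_finsetSum' _ fun i _ => integrable_smear (hηm j i).test (hki i)
  · refine (tendsto_integral_smear_sub hfi hδ0 hηm).congr fun j => integral_congr_ae ?_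
    filter_upwards [hfw] with x hx
    rw [hx, Finset.sum_apply]
  · refine (tendsto_integral_smear_sub hAi hδ0 hηm).congr fun j => integral_congr_ae ?_
    filter_upwards [hAa] with x hx
    rw [hx, Pi.sub_apply, Finset.sum_apply]
  · have hsi : ∀ i, Integrable fun x => ‖smear (η j i) τ (k i) x‖ := fun i =>
      (integrable_smear (hηm j i).test (hki i)).norm
    calc ∫ x, ‖(∑ i, smear (η j i) τ (k i)) x‖
        ≤ ∫ x, ∑ i, ‖smear (η j i) τ (k i) x‖ := by
          refine integral_mono_of_nonneg (ae_of_all _ fun x => norm_nonneg _)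
            (integrable_finsetSum _ fun i _ => hsi i) (ae_of_all _ fun x => ?_)
          simp only [Finset.sum_apply]
          exact norm_sum_le _ _
      _ = ∑ i, ∫ x, ‖smear (η j i) τ (k i) x‖ := integral_finsetSum _ fun i _ => hsi i
      _ ≤ ∑ i, ∫ x, ‖k i x‖ ∂τ := Finset.sum_le_sum fun i _ =>
          integral_norm_smear_le (hηm j i) (hki i)
      _ = ∫ x, ∑ i, ‖k i x‖ ∂τ := (integral_finsetSum _ fun i _ => (hki i).norm).symm
      -- No mass is gained: the χ_i are nonnegative and sum to one on the closure of Ω, where h is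
      -- carried.
      _ = ∫ x, ‖h x‖ ∂τ := by
          refine integral_congr_ae ?_
          filter_upwards [hhS] with x hx
          simp only [hk, norm_smul, Real.norm_of_nonneg (hχ0 _ x), ← Finset.sum_mul]
          by_cases hxS : x ∈ closure Ω
          · rw [hχ1 x hxS, one_mul]
          · simp [hx hxS]
  · simp only [Finset.sum_apply]
    exact Finset.sum_eq_zero fun i _ =>
      smear_eq_zero hhS (hCη j i) fun h => hx (hCΩ j i h)
  · obtain ⟨B, hB⟩ := hψc.exists_bound_of_continuous hψ
    have hψi : ∀ {ν : Measure (Euc n)} {g : Euc n → Mat m n}, Integrable g ν →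
        Integrable (fun x => inner ℝ (ψ x) (g x)) ν := by
      intro ν g hg
      refine (hg.norm.const_mul B).mono' (hψ.aestronglyMeasurable.inner hg.aestronglyMeasurable)
        (ae_of_all _ fun x => ?_)
      exact (norm_inner_le_norm _ _).trans (mul_le_mul_of_nonneg_right (hB x) (norm_nonneg _))
    have h1 := tendsto_finsetSum Finset.univ fun i _ =>
      tendsto_integral_inner_smear (hki i) hδ0 (fun j => hηm j i) hψ hψc
    have h2 : ∑ i, ∫ x, inner ℝ (ψ x) (k i x) ∂τ = ∫ x, inner ℝ (ψ x) (h x) ∂τ := by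
      rw [← integral_finsetSum _ fun i _ => hψi (hki i)]
      refine integral_congr_ae ?_
      filter_upwards [hkh] with x hx
      rw [← inner_sum, hx]
    rw [h2] at h1
    refine h1.congr fun j => ?_
    rw [← integral_finsetSum _ fun i _ => hψi (integrable_smear (hηm j i).test (hki i))]
    simp only [Finset.sum_apply, inner_sum]

omit hn hα₀ hα₁ in
/-- The area functional of a measure whose singular part is carried by a given bounded set. -/
lemma HasVariation.areaFunctional_eq_ofReal {u : Euc n → Euc m} {a h : Euc n → Mat m n}
    {τ : Measure (Euc n)} (H : HasVariation α u a τ h) (hτ : τ ⟂ₘ volume) {S : Set (Euc n)}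
    (hSm : MeasurableSet S) (hS : volume S ≠ ⊤) (hh : ∀ᵐ y ∂τ, y ∉ S → h y = 0) :
    areaFunctional (fracVariation α u) S =
      ENNReal.ofReal ((∫ x in S, √(1 + ‖a x‖ ^ 2)) + ∫ x, ‖h x‖ ∂τ) := by
  have : IsFiniteMeasure ((volume : Measure (Euc n)).restrict S) :=
    ⟨by simpa using hS.lt_top⟩
  rw [H.fracVariation_eq, areaFunctional_eq H.integrable_ac H.integrable_sing hτ hSm,
    ENNReal.ofReal_add (integral_nonneg fun x => Real.sqrt_nonneg _)
      (integral_nonneg fun x => norm_nonneg _),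
    ofReal_integral_eq_lintegral_ofReal (integrable_sqrt_one_add H.integrable_ac.restrict)
      (ae_of_all _ fun x => Real.sqrt_nonneg _),
    ofReal_integral_norm_eq_lintegral_enorm H.integrable_sing]
  congr 1
  rw [← lintegral_indicator hSm]
  refine lintegral_congr_ae ?_
  filter_upwards [hh] with x hx
  by_cases hxS : x ∈ S
  · simp [hxS]
  · simp [hxS, hx hxS]

omit hn hα₀ hα₁ in
lemma tendsto_eLpNorm_one {F : Type*} [NormedAddCommGroup F] {f : ℕ → Euc n → F}
    (hf : ∀ j, Integrable (f j)) (h : Tendsto (fun j => ∫ x, ‖f j x‖) atTop (𝓝 0)) :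
    Tendsto (fun j => eLpNorm (f j) 1 volume) atTop (𝓝 0) := by
  have := ENNReal.tendsto_ofReal h
  rw [ENNReal.ofReal_zero] at this
  refine this.congr fun j => ?_
  rw [eLpNorm_one_eq_lintegral_enorm, ofReal_integral_norm_eq_lintegral_enorm (hf j)]

theorem exists_areaStrictTendsto {Ω : Set (Euc n)} (hΩ : IsBoundedLipschitzDomain Ω)
    {g : Euc n → Euc m} (hg : MemS α g) {u : Euc n → Euc m} (hu : MemBVg α Ω g u) :
    ∃ uj : ℕ → Euc n → Euc m,
      (∀ j, ∃ φ : Euc n → Euc m, IsTestFunction Ω φ ∧ uj j = g + φ) ∧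
      AreaStrictTendsto α Ω g uj u := by
  obtain ⟨a, τ, h, φ, d, b, _, hτ, H, hhS, hφ, Hφ, hd, hb, hφw, hd0, hbh, hbΩ, hweak⟩ :=
    exists_approximation hn hα₀ hα₁ hΩ hu
  obtain ⟨a₀, H₀⟩ := hg.exists_hasVariation hn hα₀ hα₁
  have hS : volume (closure Ω) ≠ ⊤ := hΩ.2.1.closure.measure_lt_top.ne
  have Hu : HasVariation α u (a₀ + a) τ h := by
    simpa using (H₀ τ).add hn hα₀ hα₁ H
  have Huj : ∀ j, HasVariation α (g + φ j) (a₀ + a + d j + b j) τ 0 := fun j => by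
    have := (H₀ τ).add hn hα₀ hα₁ (Hφ j)
    rw [add_zero] at this
    simpa only [add_assoc] using this
  refine ⟨fun j => g + φ j, fun j => ⟨φ j, hφ j, rfl⟩, fun j => ?_, hu, ?_, ?_, ?_⟩
  · rw [MemBVg, add_sub_cancel_left]
    refine ⟨(Hφ j).memBV, ae_of_all _ fun x hx => ?_⟩
    exact image_eq_zero_of_notMem_tsupport fun h => hx ((hφ j).2.2 h)
  · refine (tendsto_eLpNorm_one (fun j => (Hφ j).integrable.sub H.integrable) hφw).congr
      fun j => ?_
    congr 1
    funext x
    simp only [Pi.sub_apply, Pi.add_apply]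
    abel
  · rw [Hu.areaFunctional_eq_ofReal hτ isClosed_closure.measurableSet hS hhS]
    simp only [fun j => (Huj j).areaFunctional_eq_ofReal hτ isClosed_closure.measurableSet hS
      (ae_of_all _ fun x _ => rfl)]
    refine ENNReal.tendsto_ofReal ?_
    simpa using tendsto_integral_sqrt H.integrable_sing hτ hS Hu.integrable_ac hd hb hd0 hbh
      (fun j x hx => hbΩ j x fun h => hx (subset_closure h)) hweak
  · refine tendsto_of_tendsto_of_tendsto_of_le_of_le tendsto_const_nhds
      (tendsto_eLpNorm_one hd hd0) (fun j => zero_le) fun j => ?_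
    -- Off Ω the term b_j vanishes, so only d_j separates the gradients, and it tends to zero in L¹
    -- of the whole space.
    have hae : ∀ᵐ x ∂((volume : Measure (Euc n)).restrict Ωᶜ),
        (fracGrad α (g + φ j) - fracGrad α u) x = d j x := by
      filter_upwards [ae_restrict_mem hΩ.1.measurableSet.compl,
        ae_restrict_of_ae ((Huj j).fracGrad_ae_eq hτ), ae_restrict_of_ae (Hu.fracGrad_ae_eq hτ)]
        with x hx h1 h2
      rw [Pi.sub_apply, h1, h2]
      simp [hbΩ j x hx]
    simp only [eLpNorm_congr_ae hae]
    exact eLpNorm_mono_measure _ Measure.restrict_le_self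

end FractionalBV

theorem theorem3p6 {n m : ℕ} (hn : 1 ≤ n) (α : ℝ) (hα₀ : 0 < α) (hα₁ : α < 1)
    (Ω : Set (FractionalBV.Euc n)) (hΩ : FractionalBV.IsBoundedLipschitzDomain Ω)
    (g : FractionalBV.Euc n → FractionalBV.Euc m) (hg : FractionalBV.MemS α g)
    (u : FractionalBV.Euc n → FractionalBV.Euc m) (hu : FractionalBV.MemBVg α Ω g u) :
    ∃ uj : ℕ → FractionalBV.Euc n → FractionalBV.Euc m,
      (∀ j, ∃ φ : FractionalBV.Euc n → FractionalBV.Euc m,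
        FractionalBV.IsTestFunction Ω φ ∧ uj j = g + φ) ∧
      FractionalBV.AreaStrictTendsto α Ω g uj u := by
  exact FractionalBV.exists_areaStrictTendsto hn hα₀ hα₁ hΩ hg hu
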